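/- Let $n\ge 1$ and let $\mathbb H^n=\mathbb R^{2n+1}$ be the Heisenberg group, with points $(x,t)=(x_1,\dots,x_{2n},t)$, horizontal vector fields $X_i=\partial_{x_i}-\frac{x_{n+i}}2\partial_t$ and $X_{n+i}=\partial_{x_{n+i}}+\frac{x_i}2\partial_t$ $(1\le i\le n)$, horizontal gradient $\mathfrak X u=(X_1u,\dots,X_{2n}u)$, horizontal divergence $\operatorname{div}_H F=\sum_{i=1}^{2n}X_iF_i$, homogeneous dimension $Q=2n+2$, Carnot–Carathéodory distance $d$ (the infimum of the lengths of horizontal curves joining two points) and open $d$-balls $B_r(x_0)$. For open $U$, $HW^{1,p}(U)$ is the space of $u\in L^p(U)$ whose distributional horizontal gradient $\mathfrak Xu$ is in $L^p(U;\mathbb R^{2n})$, with norm $\|u\|_{L^p(U)}+\|\mathfrak Xu\|_{L^p(U)}$, and $HW^{1,p}_0(U)$ is the closure of $C_0^\infty(U)$ in it. Let $p\ge 2$ and $L\ge 1$. Then there is a constant $c=c(n,p,L)>0$ with the following property. Let $\Omega\subseteq\mathbb H^n$ be a domain, and let $a:\Omega\times\mathbb R^{2n}\to\mathbb R^{2n}$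 be continuous, of class $C^1$ in the second variable, with $D_za(x,z)$ symmetric, and such that for some $L'\ge1$, $s\ge0$, $\alpha\in(0,1]$ and all $x,y\in\Omega$, $z,\xi\in\mathbb R^{2n}$, $$(|z|^2+s^2)^{\frac{p-2}2}|\xi|^2\le\langle D_za(x,z)\xi,\xi\rangle\le L(|z|^2+s^2)^{\frac{p-2}2}|\xi|^2,$$ $$|a(x,z)-a(y,z)|\le L'|z|(|z|^2+s^2)^{\frac{p-2}2}|x-y|^\alpha,$$ where $|x-y|$ is the Euclidean distance or, alternatively, stands for $d(x,y)$. Let $\mu$ be a signed Radon measure on $\mathbb H^n$ with $|\mu|(\Omega)<\infty$ and $|\mu|(\mathbb H^n\setminus\Omega)=0$, and let $u\in HW^{1,p}(\Omega)$ be a weak solution of $-\operatorname{div}_H a(x,\mathfrak Xu)=\mu$ in $\Omega$, that is, $\int_\Omega\langle a(x,\mathfrak Xu),\mathfrak X\varphi\rangle\,dx=\int_\Omega\varphi\,d\mu$ for all $\varphi\in C_0^\infty(\Omega)$. Let $x_0\in\Omega$ and $R>0$ with $B_{2R}=B_{2R}(x_0)\subset\Omega$, and let $w\in HW^{1,p}(B_{2R})$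 be a weak solution of $\operatorname{div}_H a(x,\mathfrak Xw)=0$ in $B_{2R}$ with $w-u\in HW^{1,p}_0(B_{2R})$. Then $$\frac1{|B_{2R}|}\int_{B_{2R}}|\mathfrak Xw-\mathfrak Xu|\,dx\le c\left(\frac{|\mu|(B_{2R})}{R^{Q-1}}\right)^{\frac1{p-1}}.$$ -/

import Mathlib

open MeasureTheory Set
open scoped ContDiff ENNReal

noncomputable section

namespace Heisenberg

/-- The horizontal fibre `ℝ²ⁿ` with its Euclidean norm; `Sum.inl i` is the index `i` and
`Sum.inr i` is the index `n + i`, for `1 ≤ i ≤ n`. -/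
abbrev Hor (n : ℕ) : Type := EuclideanSpace ℝ (Fin n ⊕ Fin n)

/-- The Heisenberg group as a set: points `(x, t)` of `ℝ²ⁿ × ℝ = ℝ²ⁿ⁺¹`. Its topology, smooth
structure and Haar measure are those of `ℝ²ⁿ⁺¹` (the instance norm of the product is
never used as a distance below). -/
abbrev Heis (n : ℕ) : Type := Hor n × ℝ

/-- The homogeneous dimension `Q = 2n + 2`. -/
def homDim (n : ℕ) : ℕ := 2 * n + 2

/-- The left invariant horizontal vector fields
`X_i = ∂_{x_i} - (x_{n+i} / 2) ∂_t` and `X_{n+i} = ∂_{x_{n+i}} + (x_i / 2) ∂_t`. -/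
def X {n : ℕ} : Fin n ⊕ Fin n → Heis n → Heis n
  | Sum.inl i, x => (EuclideanSpace.single (Sum.inl i) 1, -(x.1 (Sum.inr i) / 2))
  | Sum.inr i, x => (EuclideanSpace.single (Sum.inr i) 1, x.1 (Sum.inl i) / 2)

/-- The classical horizontal gradient `(X_1 φ, …, X_{2n} φ)` of a differentiable function. -/
def horGrad {n : ℕ} (φ : Heis n → ℝ) (x : Heis n) : Hor n :=
  WithLp.toLp 2 fun i => fderiv ℝ φ x (X i x)

/-- The Euclidean distance of `ℝ²ⁿ⁺¹`. -/
def euclDist {n : ℕ} (x y : Heis n) : ℝ :=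
  Real.sqrt (‖x.1 - y.1‖ ^ 2 + (x.2 - y.2) ^ 2)

/-- `γ`, restricted to `[0,1]`, is a horizontal curve from `x` to `y` with control `h`: it is
absolutely continuous, and `γ' = ∑ h_i X_i(γ)` a.e. (in integrated form). -/
structure IsHorizontalCurve {n : ℕ} (x y : Heis n) (γ : ℝ → Heis n) (h : ℝ → Hor n) :
    Prop where
  integrable : IntervalIntegrable h volume 0 1
  continuousOn : ContinuousOn γ (Icc 0 1)
  eq_integral : ∀ t ∈ Icc (0 : ℝ) 1, γ t = x + ∫ s in (0 : ℝ)..t, ∑ i, h s i • X i (γ s)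
  endpoint : γ 1 = y

/-- The Carnot–Carathéodory distance: the infimum of the lengths `∫₀¹ |h|` of the horizontal
curves from `x` to `y`. -/
def ccEDist {n : ℕ} (x y : Heis n) : ℝ≥0∞ :=
  ⨅ (γ : ℝ → Heis n) (h : ℝ → Hor n) (_ : IsHorizontalCurve x y γ h),
    ∫⁻ s in Icc (0 : ℝ) 1, ‖h s‖ₑ

/-- The open metric ball `B_r(x)` of the Carnot–Carathéodory distance. -/
def ccBall {n : ℕ} (x : Heis n) (r : ℝ) : Set (Heis n) :=
  {y | ccEDist x y < ENNReal.ofReal r}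

/-- `φ ∈ C_0^∞(U)`. -/
structure IsTest {n : ℕ} (U : Set (Heis n)) (φ : Heis n → ℝ) : Prop where
  smooth : ContDiff ℝ ∞ φ
  compact : HasCompactSupport φ
  support : tsupport φ ⊆ U

/-- `u ∈ HW^{1,p}(U)`, with distributional horizontal gradient `g` (which is determined a.e. on
`U` by `u`). -/
structure MemHW {n : ℕ} (p : ℝ) (U : Set (Heis n)) (u : Heis n → ℝ) (g : Heis n → Hor n) :
    Prop where
  memLp : MemLp u (ENNReal.ofReal p) (volume.restrict U)
  grad_memLp : MemLp g (ENNReal.ofReal p) (volume.restrict U)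
  grad : ∀ φ, IsTest U φ → ∀ i,
    ∫ x in U, u x * horGrad φ x i = -∫ x in U, g x i * φ x

/-- `v ∈ HW_0^{1,p}(U)`, with distributional horizontal gradient `g`: `v` lies in the closure of
`C_0^∞(U)` in `HW^{1,p}(U)` with respect to the norm `‖v‖_{L^p(U)} + ‖𝔛v‖_{L^p(U)}`. -/
structure MemHW0 {n : ℕ} (p : ℝ) (U : Set (Heis n)) (v : Heis n → ℝ) (g : Heis n → Hor n) :
    Prop where
  memHW : MemHW p U v g
  approx : ∀ ε : ℝ≥0∞, 0 < ε → ∃ φ, IsTest U φ ∧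
    eLpNorm (v - φ) (ENNReal.ofReal p) (volume.restrict U) +
      eLpNorm (g - horGrad φ) (ENNReal.ofReal p) (volume.restrict U) < ε

/-- The integral of a function against a finite signed measure. -/
def signedIntegral {n : ℕ} (μ : SignedMeasure (Heis n)) (φ : Heis n → ℝ) : ℝ :=
  ∫ x, φ x ∂μ.toJordanDecomposition.posPart - ∫ x, φ x ∂μ.toJordanDecomposition.negPart

/-- `u ∈ HW^{1,p}(U)`, with horizontal gradient `g`, is a weak solution of
`-div_H a(x, 𝔛u) = μ` in `U`. -/
structure IsWeakSolution {n : ℕ} (p : ℝ) (U : Set (Heis n)) (a : Heis n → Hor n → Hor n)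
    (μ : SignedMeasure (Heis n)) (u : Heis n → ℝ) (g : Heis n → Hor n) : Prop where
  memHW : MemHW p U u g
  weak : ∀ φ, IsTest U φ →
    ∫ x in U, inner ℝ (a x (g x)) (horGrad φ x) = signedIntegral μ φ

/-- The Hölder condition
`|a(x,z) - a(y,z)| ≤ L' |z| (|z|² + s²)^{(p-2)/2} ρ(x,y)^α` on `Ω`, for a distance `ρ`. -/
def HolderIn {n : ℕ} (p L' s α : ℝ) (ρ : Heis n → Heis n → ℝ) (Ω : Set (Heis n))
    (a : Heis n → Hor n → Hor n) : Prop :=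
  ∀ x ∈ Ω, ∀ y ∈ Ω, ∀ z,
    ‖a x z - a y z‖ ≤ L' * ‖z‖ * (‖z‖ ^ 2 + s ^ 2) ^ ((p - 2) / 2) * ρ x y ^ α

/-- The structure condition on `a : Ω × ℝ²ⁿ → ℝ²ⁿ`. The Hölder condition in `x` may be taken with
respect to the Euclidean distance or to the Carnot–Carathéodory distance. -/
structure StructureCondition {n : ℕ} (p L L' s α : ℝ) (Ω : Set (Heis n))
    (a : Heis n → Hor n → Hor n) : Prop where
  continuousOn : ContinuousOn (fun q : Heis n × Hor n => a q.1 q.2) (Ω ×ˢ univ)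
  contDiff : ∀ x ∈ Ω, ContDiff ℝ 1 (a x)
  symm : ∀ x ∈ Ω, ∀ z ξ η,
    inner ℝ (fderiv ℝ (a x) z ξ) η = inner ℝ ξ (fderiv ℝ (a x) z η)
  lower : ∀ x ∈ Ω, ∀ z ξ,
    (‖z‖ ^ 2 + s ^ 2) ^ ((p - 2) / 2) * ‖ξ‖ ^ 2 ≤ inner ℝ (fderiv ℝ (a x) z ξ) ξ
  upper : ∀ x ∈ Ω, ∀ z ξ,
    inner ℝ (fderiv ℝ (a x) z ξ) ξ ≤ L * (‖z‖ ^ 2 + s ^ 2) ^ ((p - 2) / 2) * ‖ξ‖ ^ 2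
  holder : HolderIn p L' s α euclDist Ω a ∨
    HolderIn p L' s α (fun x y => (ccEDist x y).toReal) Ω a

end Heisenberg

end

/-! The estimate is elementary and needs no case distinction in `p`. Write `B` for the ball of radius
`r = 2R`, `g = 𝔛w - 𝔛u`, and `A = r ^ (-Q) ∫_B |g|`, so that `k = A r` is the natural scale of the
difference `w - u`.

The equation for `w` minus that for `u` is tested with `ψ(φ)`, where `φ ∈ C_0^∞(B)` approximates
`w - u` and `ψ` is a smooth bounded function with `ψ(0) = 0`, `ψ' = (1 + (t / k)²)^{-γ/2}` and
`γ > 1` close to `1`. As `|ψ| ≤ C k`, strong monotonicity of `a` gives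
`∫_B ψ'(φ) |g| ^ p ≤ C k |μ|(B)` up to an arbitrarily small error (`exists_test_integral_le`). Only
the smooth `φ` is ever composed with `ψ`, so no limit of truncations has to be taken. A pointwise
form of Hölder's inequality with weight `ψ'(φ)` (`le_weighted_add`) then bounds `∫_B |g|` by this
energy and a small multiple of `∫_B 1 / ψ'(φ) = ∫_B (1 + (φ / k)²)^{γ/2}`, and absorbing gives
`A ^ (p - 1) ≤ C |μ|(B) / r ^ (Q - 1)` (`exists_rpow_le`).

What remains is the bound `∫_B (1 + (φ / k)²)^{γ/2} ≤ C r ^ Q`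
(`exists_lintegral_one_add_sq_rpow_le`), a Sobolev inequality from `L¹` with a small gain of
integrability. Right translation by `(ξ, τ)` moves `φ` in `L¹` by at most
`(|ξ| + 4 |τ|^{1/2}) ∫ |𝔛φ|`, because vertical translations are commutators of horizontal ones
(`lintegral_translate_le`). So `φ` differs from its averages over translates of a box of radius `ρ`
by `O(ρ)` in `L¹`, whereas the averages are bounded by `ρ ^ (-Q) ∫ |φ|`; choosing `ρ` according to
the level gives a weak-type inequality with exponent `1 + 1 / Q`, and hence a strong one with
exponent `γ = 1 + 1 / (2Q)`.

Balls enter only through the ball-box inclusions `ccBall_subset` and `subset_ccBall`; measurability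
of the balls is never used. -/

noncomputable section

namespace Heisenberg

variable {n : ℕ}

/-! ### The group structure and translations -/

/-- The complex structure on the horizontal fibre, `J e_i = e_{n+i}` and `J e_{n+i} = -e_i`. The
standard symplectic form is `(x, y) ↦ ⟪J x, y⟫`. -/
def J : Hor n →ₗᵢ[ℝ] Hor n where
  toFun x := WithLp.toLp 2 (Sum.elim (fun i => -x (Sum.inr i)) fun i => x (Sum.inl i))
  map_add' x y := by
    ext i; rcases i with i | i <;> simp [add_comm]
  map_smul' c x := by
    ext i; rcases i with i | i <;> simp
  norm_map' x := by
    simp [EuclideanSpace.norm_eq, Fintype.sum_sum_type, add_comm]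

@[simp] lemma J_inl (x : Hor n) (i : Fin n) : J x (Sum.inl i) = -x (Sum.inr i) := rfl

@[simp] lemma J_inr (x : Hor n) (i : Fin n) : J x (Sum.inr i) = x (Sum.inl i) := rfl

lemma inner_J_swap (x y : Hor n) : inner ℝ (J x) y = -inner ℝ (J y) x := by
  simp only [PiLp.inner_apply, Fintype.sum_sum_type, J_inl, J_inr, neg_add, ← Finset.sum_neg_distrib]
  rw [add_comm]
  congr 1 <;> refine Finset.sum_congr rfl fun i _ => ?_ <;> simp [mul_comm]

@[simp] lemma inner_J_self (x : Hor n) : inner ℝ (J x) x = 0 := by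
  have := inner_J_swap x x
  linarith

lemma abs_inner_J_le (x y : Hor n) : |inner ℝ (J x) y| ≤ ‖x‖ * ‖y‖ := by
  simpa using abs_real_inner_le_norm (J x) y

/-- The group law of the Heisenberg group. -/
def mul (x y : Heis n) : Heis n :=
  (x.1 + y.1, x.2 + y.2 + inner ℝ (J x.1) y.1 / 2)

lemma mul_mul (x y z : Heis n) : mul (mul x y) z = mul x (mul y z) := by
  ext1
  · simp [mul, add_assoc]
  · simp only [mul, map_add, inner_add_left, inner_add_right]; ring

@[fun_prop]
lemma continuous_J : Continuous (J (n := n)) := J.continuous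

lemma continuous_mul : Continuous fun q : Heis n × Heis n => mul q.1 q.2 := by
  refine Continuous.prodMk (by fun_prop) ?_
  fun_prop

lemma X_eq (i : Fin n ⊕ Fin n) (x : Heis n) :
    X i x = (EuclideanSpace.single i 1, J x.1 i / 2) := by
  rcases i with i | i
  · simp [X, neg_div]
  · simp [X]

/-- The horizontal vector at `x` with coordinates `ξ`. -/
lemma sum_smul_X (ξ : Hor n) (x : Heis n) :
    ∑ i, ξ i • X i x = (ξ, inner ℝ (J x.1) ξ / 2) := by
  ext1
  · rw [Prod.fst_sum]
    ext j
    simp only [X_eq, Prod.smul_mk, WithLp.ofLp_sum, Finset.sum_apply, PiLp.smul_apply,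
      PiLp.single_apply, smul_eq_mul, mul_ite, mul_one, mul_zero, Finset.sum_ite_eq,
      Finset.mem_univ, if_true]
  · rw [Prod.snd_sum]
    simp only [X_eq, Prod.smul_mk, smul_eq_mul, PiLp.inner_apply, Finset.sum_div]
    refine Finset.sum_congr rfl fun i _ => ?_
    simp [mul_div_assoc]

lemma inner_horGrad (φ : Heis n → ℝ) (x : Heis n) (ξ : Hor n) :
    inner ℝ (horGrad φ x) ξ = fderiv ℝ φ x (ξ, inner ℝ (J x.1) ξ / 2) := by
  rw [← sum_smul_X, map_sum, PiLp.inner_apply]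
  refine Finset.sum_congr rfl fun i _ => ?_
  rw [map_smul]; rfl

lemma continuous_horGrad {φ : Heis n → ℝ} (hφ : ContDiff ℝ 1 φ) : Continuous (horGrad φ) := by
  have h1 := hφ.continuous_fderiv one_ne_zero
  refine (PiLp.continuous_toLp 2 _).comp (continuous_pi fun i => ?_)
  refine h1.clm_apply ?_
  rw [show X i = _ from funext (X_eq i)]
  exact continuous_const.prodMk (((EuclideanSpace.proj (𝕜 := ℝ) i).continuous.comp
    (continuous_J.comp continuous_fst)).div_const 2)

lemma horGrad_eq_zero {φ : Heis n → ℝ} {x : Heis n} (hx : x ∉ tsupport φ) : horGrad φ x = 0 := by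
  have h := fderiv_of_notMem_tsupport (𝕜 := ℝ) hx
  ext i
  simp [horGrad, h]

lemma horGrad_comp {φ : Heis n → ℝ} {ψ : ℝ → ℝ} {x : Heis n} (hψ : DifferentiableAt ℝ ψ (φ x))
    (hφ : DifferentiableAt ℝ φ x) :
    horGrad (fun y => ψ (φ y)) x = deriv ψ (φ x) • horGrad φ x := by
  have : fderiv ℝ (fun y => ψ (φ y)) x = deriv ψ (φ x) • fderiv ℝ φ x :=
    (hψ.hasDerivAt.comp_hasFDerivAt x hφ.hasFDerivAt).fderiv
  ext i
  simp [horGrad, this]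

/-- Right translations preserve Lebesgue measure. -/
lemma measurePreserving_mul_right (y : Heis n) :
    MeasurePreserving (fun x : Heis n => mul x y) := by
  have hc : Continuous fun q : Hor n × ℝ => q.2 + y.2 + inner ℝ (J q.1) y.1 / 2 := by
    fun_prop
  refine MeasurePreserving.skew_product (f := fun x : Hor n => x + y.1)
    (g := fun x t => t + y.2 + inner ℝ (J x) y.1 / 2)
    (measurePreserving_add_right volume y.1) hc.measurable (Filter.Eventually.of_forall fun x => ?_)
  have := (measurePreserving_add_right (volume : Measure ℝ) (y.2 + inner ℝ (J x) y.1 / 2)).map_eq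
  simpa only [add_assoc] using this

/-- Left translations preserve Lebesgue measure. -/
lemma measurePreserving_mul_left (y : Heis n) :
    MeasurePreserving (fun x : Heis n => mul y x) := by
  have hc : Continuous fun q : Hor n × ℝ => y.2 + q.2 + inner ℝ (J y.1) q.1 / 2 := by
    fun_prop
  refine MeasurePreserving.skew_product (f := fun x : Hor n => y.1 + x)
    (g := fun x t => y.2 + t + inner ℝ (J y.1) x / 2)
    (measurePreserving_add_left volume y.1) hc.measurable (Filter.Eventually.of_forall fun x => ?_)
  have := (measurePreserving_add_right (volume : Measure ℝ) (y.2 + inner ℝ (J y.1) x / 2)).map_eq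
  have h : (fun t : ℝ => y.2 + t + inner ℝ (J y.1) x / 2) =
      fun t => t + (y.2 + inner ℝ (J y.1) x / 2) := by
    ext t; ring
  simpa only [h] using this

lemma continuous_mul_right (y : Heis n) : Continuous fun x : Heis n => mul x y :=
  continuous_mul.comp (by fun_prop : Continuous fun x : Heis n => (x, y))

lemma continuous_mul_left (y : Heis n) : Continuous fun x : Heis n => mul y x :=
  continuous_mul.comp (by fun_prop : Continuous fun x : Heis n => (y, x))

lemma hasDerivAt_mul_horizontal {φ : Heis n → ℝ} (hφ : ContDiff ℝ 1 φ) (x : Heis n) (ξ : Hor n)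
    (s : ℝ) : HasDerivAt (fun s : ℝ => φ (mul x (s • ξ, 0)))
      (inner ℝ (horGrad φ (mul x (s • ξ, 0))) ξ) s := by
  have hg : HasDerivAt (fun s : ℝ => mul x (s • ξ, 0)) (ξ, inner ℝ (J x.1) ξ / 2) s := by
    have h1 : HasDerivAt (fun s : ℝ => x.1 + s • ξ) ξ s := by
      simpa using ((hasDerivAt_id s).smul_const ξ).const_add x.1
    have h2 : HasDerivAt (fun s : ℝ => x.2 + 0 + inner ℝ (J x.1) (s • ξ) / 2)
        (inner ℝ (J x.1) ξ / 2) s := by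
      simp only [inner_smul_right]
      simpa using (((hasDerivAt_id s).mul_const (inner ℝ (J x.1) ξ)).div_const 2).const_add (x.2 + 0)
    exact h1.prodMk h2
  have := ((hφ.differentiable one_ne_zero _).hasFDerivAt).comp_hasDerivAt s hg
  rw [inner_horGrad]
  have h2 : inner ℝ (J (mul x (s • ξ, 0)).1) ξ = inner ℝ (J x.1) ξ := by
    simp only [mul, map_add, map_smul, inner_add_left, inner_smul_left, inner_J_self]
    ring
  rw [h2]
  exact this

/-- Translating along a horizontal direction costs at most its length times the horizontal
gradient, in `L¹`. -/
lemma lintegral_translate_horizontal_le {φ : Heis n → ℝ} (hφ : ContDiff ℝ 1 φ) (ξ : Hor n) :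
    ∫⁻ x, ‖φ (mul x (ξ, 0)) - φ x‖ₑ ≤ ‖ξ‖ₑ * ∫⁻ x, ‖horGrad φ x‖ₑ := by
  have hc : Continuous fun q : Heis n × ℝ => horGrad φ (mul q.1 (q.2 • ξ, 0)) :=
    (continuous_horGrad hφ).comp
      (continuous_mul.comp (by fun_prop : Continuous fun q : Heis n × ℝ => (q.1, (q.2 • ξ, (0:ℝ)))))
  have key : ∀ x : Heis n, ‖φ (mul x (ξ, 0)) - φ x‖ₑ ≤
      ∫⁻ s in Ioc (0 : ℝ) 1, ‖ξ‖ₑ * ‖horGrad φ (mul x (s • ξ, 0))‖ₑ := by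
    intro x
    have hcx : Continuous fun s : ℝ => horGrad φ (mul x (s • ξ, 0)) :=
      hc.comp (by fun_prop : Continuous fun s : ℝ => (x, s))
    have h1 := intervalIntegral.integral_eq_sub_of_hasDerivAt
      (fun s _ => hasDerivAt_mul_horizontal hφ x ξ s)
      ((by fun_prop : Continuous fun s : ℝ =>
        inner ℝ (horGrad φ (mul x (s • ξ, 0))) ξ).intervalIntegrable 0 1)
    have h0 : mul x (((0:ℝ) • ξ), (0:ℝ)) = x := by simp [mul]
    rw [one_smul, h0] at h1
    rw [← h1, intervalIntegral.integral_of_le zero_le_one]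
    refine (enorm_integral_le_lintegral_enorm _).trans (lintegral_mono fun s => ?_)
    rw [← ofReal_norm, ← ofReal_norm, ← ofReal_norm, ← ENNReal.ofReal_mul (norm_nonneg _), mul_comm]
    exact ENNReal.ofReal_le_ofReal (norm_inner_le_norm _ _)
  calc ∫⁻ x, ‖φ (mul x (ξ, 0)) - φ x‖ₑ
      ≤ ∫⁻ x, ∫⁻ s in Ioc (0 : ℝ) 1, ‖ξ‖ₑ * ‖horGrad φ (mul x (s • ξ, 0))‖ₑ := lintegral_mono key
    _ = ∫⁻ s in Ioc (0 : ℝ) 1, ∫⁻ x, ‖ξ‖ₑ * ‖horGrad φ (mul x (s • ξ, 0))‖ₑ := by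
        refine lintegral_lintegral_swap ?_
        exact (hc.enorm.measurable.const_mul _).aemeasurable
    _ = ∫⁻ s in Ioc (0 : ℝ) 1, ‖ξ‖ₑ * ∫⁻ x, ‖horGrad φ x‖ₑ := by
        refine lintegral_congr fun s => ?_
        rw [lintegral_const_mul']
        · congr 1
          exact (measurePreserving_mul_right (s • ξ, (0:ℝ))).lintegral_comp
            (continuous_horGrad hφ).enorm.measurable
        · exact enorm_ne_top
    _ = _ := by simp

/-- The `L¹` translation cost is subadditive in the group element. -/
lemma lintegral_translate_mul_le {φ : Heis n → ℝ} (hφ : Continuous φ) (y z : Heis n) :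
    ∫⁻ x, ‖φ (mul x (mul y z)) - φ x‖ₑ ≤
      (∫⁻ x, ‖φ (mul x y) - φ x‖ₑ) + ∫⁻ x, ‖φ (mul x z) - φ x‖ₑ := by
  have hm : ∀ z, Measurable fun x => ‖φ (mul x z) - φ x‖ₑ := fun z =>
    ((hφ.comp (continuous_mul_right z)).sub hφ).enorm.measurable
  rw [← (measurePreserving_mul_right y).lintegral_comp (hm z), ← lintegral_add_left (hm y)]
  refine lintegral_mono fun x => ?_
  rw [← mul_mul, add_comm]
  simpa using enorm_add_le (φ (mul (mul x y) z) - φ (mul x y)) (φ (mul x y) - φ x)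

lemma exists_mul_eq_abs_eq_sqrt (τ : ℝ) : ∃ a b : ℝ, a * b = τ ∧ |a| = √|τ| ∧ |b| = √|τ| := by
  rcases le_total 0 τ with h | h
  · exact ⟨√|τ|, √|τ|, by rw [Real.mul_self_sqrt (abs_nonneg _), abs_of_nonneg h],
      abs_of_nonneg (Real.sqrt_nonneg _), abs_of_nonneg (Real.sqrt_nonneg _)⟩
  · refine ⟨√|τ|, -√|τ|, ?_, abs_of_nonneg (Real.sqrt_nonneg _), ?_⟩
    · rw [mul_neg, Real.mul_self_sqrt (abs_nonneg _), abs_of_nonpos h, neg_neg]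
    · rw [abs_neg, abs_of_nonneg (Real.sqrt_nonneg _)]

/-- Vertical translations are commutators of horizontal ones, and so cost the square root of their
size. -/
lemma lintegral_translate_vertical_le (hn : 1 ≤ n) {φ : Heis n → ℝ} (hφ : ContDiff ℝ 1 φ)
    (τ : ℝ) : ∫⁻ x, ‖φ (mul x (0, τ)) - φ x‖ₑ ≤
      ENNReal.ofReal (4 * √|τ|) * ∫⁻ x, ‖horGrad φ x‖ₑ := by
  obtain ⟨a, b, hab, ha, hb⟩ := exists_mul_eq_abs_eq_sqrt τ
  let i : Fin n := ⟨0, hn⟩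
  let e : Hor n := EuclideanSpace.single (Sum.inl i) 1
  let f : Hor n := EuclideanSpace.single (Sum.inr i) 1
  have hJe : inner ℝ (J e) f = (1:ℝ) := by simp [e, f, PiLp.inner_apply]
  have hJf : inner ℝ (J f) e = (-1:ℝ) := by rw [inner_J_swap, hJe]
  have hcomm : ((0 : Hor n), τ) =
      mul (mul (a • e, 0) (b • f, 0)) (mul ((-a) • e, 0) ((-b) • f, 0)) := by
    ext1
    · simp only [mul]; module
    · simp only [mul, map_smul, map_add, inner_add_left, inner_add_right, inner_smul_left,
        inner_smul_right, hJe, hJf, inner_J_self, ← hab]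
      simp; ring
  have he : ‖e‖ = 1 := by simp [e]
  have hf : ‖f‖ = 1 := by simp [f]
  have hh : ∀ (c : ℝ) (v : Hor n), |c| = √|τ| → ‖v‖ = 1 →
      ∫⁻ x, ‖φ (mul x (c • v, 0)) - φ x‖ₑ ≤ ENNReal.ofReal (√|τ|) * ∫⁻ x, ‖horGrad φ x‖ₑ := by
    intro c v hc hv
    refine (lintegral_translate_horizontal_le hφ _).trans_eq ?_
    rw [← ofReal_norm, norm_smul, hv, mul_one, Real.norm_eq_abs, hc]
  rw [hcomm]
  refine (lintegral_translate_mul_le hφ.continuous _ _).trans ?_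
  refine (add_le_add (lintegral_translate_mul_le hφ.continuous _ _)
    (lintegral_translate_mul_le hφ.continuous _ _)).trans ?_
  refine (add_le_add (add_le_add (hh a e ha he) (hh b f hb hf))
    (add_le_add (hh (-a) e (by rw [abs_neg, ha]) he) (hh (-b) f (by rw [abs_neg, hb]) hf))).trans_eq ?_
  rw [ENNReal.ofReal_mul (by norm_num), ENNReal.ofReal_ofNat]
  ring

lemma lintegral_translate_le (hn : 1 ≤ n) {φ : Heis n → ℝ} (hφ : ContDiff ℝ 1 φ) (y : Heis n) :
    ∫⁻ x, ‖φ (mul x y) - φ x‖ₑ ≤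
      ENNReal.ofReal (‖y.1‖ + 4 * √|y.2|) * ∫⁻ x, ‖horGrad φ x‖ₑ := by
  have hy : y = mul (y.1, 0) (0, y.2) := by simp [mul]
  conv_lhs => rw [hy]
  refine (lintegral_translate_mul_le hφ.continuous _ _).trans ?_
  rw [ENNReal.ofReal_add (norm_nonneg _) (by positivity), add_mul, ofReal_norm]
  exact add_le_add (lintegral_translate_horizontal_le hφ _)
    (lintegral_translate_vertical_le hn hφ _)

/-! ### Balls and boxes -/

/-- The homogeneous box of radius `ρ` about the identity. Its translate by `x` appears below as
`mul (-x) ⁻¹' box n ρ`, where `-x`, the negative in the vector space, is also the group inverse. -/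
def box (n : ℕ) (ρ : ℝ) : Set (Heis n) := Metric.closedBall 0 ρ ×ˢ Icc (-ρ ^ 2) (ρ ^ 2)

/-- The volume of the homogeneous box of radius `1`. -/
def boxVol (n : ℕ) : ℝ := 2 * volume.real (Metric.ball (0 : Hor n) 1)

lemma boxVol_pos : 0 < boxVol n := by
  refine mul_pos two_pos (ENNReal.toReal_pos ?_ measure_ball_lt_top.ne)
  exact (Metric.measure_ball_pos volume _ one_pos).ne'

lemma measurableSet_box (ρ : ℝ) : MeasurableSet (box n ρ) :=
  Metric.isClosed_closedBall.measurableSet.prod measurableSet_Icc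

lemma volume_box {ρ : ℝ} (hρ : 0 ≤ ρ) :
    volume (box n ρ) = ENNReal.ofReal (boxVol n * ρ ^ homDim n) := by
  have hv : volume (Metric.ball (0 : Hor n) 1) =
      ENNReal.ofReal (volume.real (Metric.ball (0 : Hor n) 1)) :=
    (ENNReal.ofReal_toReal measure_ball_lt_top.ne).symm
  rw [box, Measure.volume_eq_prod, Measure.prod_prod, Measure.addHaar_closedBall _ _ hρ,
    Real.volume_Icc, hv, ← ENNReal.ofReal_mul (by positivity), ← ENNReal.ofReal_mul (by positivity)]
  congr 1
  have hd : Module.finrank ℝ (Hor n) = 2 * n := by simp [two_mul]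
  rw [hd, boxVol, homDim, pow_add]
  ring

lemma volume_translate_box (x : Heis n) {ρ : ℝ} (hρ : 0 ≤ ρ) :
    volume (mul x ⁻¹' box n ρ) = ENNReal.ofReal (boxVol n * ρ ^ homDim n) := by
  rw [← volume_box hρ]
  exact (measurePreserving_mul_left x).measure_preimage (measurableSet_box ρ).nullMeasurableSet

lemma IsHorizontalCurve.integrableOn {x y : Heis n} {γ : ℝ → Heis n} {h : ℝ → Hor n}
    (H : IsHorizontalCurve x y γ h) :
    IntegrableOn (fun s => (h s, inner ℝ (J (γ s).1) (h s) / 2)) (Ioc 0 1) := by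
  have hh : IntegrableOn h (Ioc 0 1) :=
    (intervalIntegrable_iff_integrableOn_Ioc_of_le zero_le_one).1 H.integrable
  have hc : ContinuousOn (fun s => J (γ s).1) (Icc 0 1) :=
    continuous_J.comp_continuousOn (continuous_fst.comp_continuousOn H.continuousOn)
  obtain ⟨C, hC⟩ := isCompact_Icc.exists_bound_of_continuousOn hc
  refine Integrable.prodMk hh ?_
  refine Integrable.mono' (hh.norm.const_mul C) ?_ ?_
  · have h1 := (hc.mono Ioc_subset_Icc_self).aestronglyMeasurable measurableSet_Ioc (μ := volume)
    have h2 := (h1.inner (𝕜 := ℝ) hh.aestronglyMeasurable).mul_const (2 : ℝ)⁻¹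
    exact h2
  · filter_upwards [ae_restrict_mem measurableSet_Ioc] with s hs
    have h1 := norm_inner_le_norm (𝕜 := ℝ) (J (γ s).1) (h s)
    have h2 := mul_le_mul_of_nonneg_right (hC s (Ioc_subset_Icc_self hs)) (norm_nonneg (h s))
    rw [norm_div, Real.norm_two]
    have h3 := norm_nonneg (inner ℝ (J (γ s).1) (h s))
    linarith

/-- The ball-box inclusion from outside: the vertical displacement of a horizontal curve, measured
from the left translate, is quadratic in its length. -/
lemma ccBall_subset (x : Heis n) (r : ℝ) : ccBall x r ⊆ mul (-x) ⁻¹' box n r := by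
  intro y hy
  simp only [ccBall, ccEDist, Set.mem_ofPred_eq, iInf_lt_iff] at hy
  obtain ⟨γ, h, H, hl⟩ := hy
  have hr : 0 < r := by
    by_contra hr
    rw [ENNReal.ofReal_of_nonpos (not_lt.1 hr)] at hl
    exact not_lt_bot hl
  have hF := H.integrableOn
  have hh : IntegrableOn h (Ioc 0 1) :=
    (intervalIntegrable_iff_integrableOn_Ioc_of_le zero_le_one).1 H.integrable
  have hlen : ∫ s in Ioc (0:ℝ) 1, ‖h s‖ ≤ r := by
    rw [integral_norm_eq_lintegral_enorm hh.aestronglyMeasurable]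
    refine ENNReal.toReal_le_of_le_ofReal hr.le (le_trans ?_ hl.le)
    exact lintegral_mono_set Ioc_subset_Icc_self
  have hsub : ∀ t ∈ Icc (0:ℝ) 1, IntegrableOn (fun s => (h s, inner ℝ (J (γ s).1) (h s) / 2))
      (Ioc 0 t) := fun t ht => hF.mono_set (Ioc_subset_Ioc_right ht.2)
  have hle : ∀ t ∈ Icc (0:ℝ) 1, ∫ s in Ioc 0 t, ‖h s‖ ≤ r := fun t ht =>
    (setIntegral_mono_set hh.norm (Filter.Eventually.of_forall fun _ => norm_nonneg _)
      (Ioc_subset_Ioc_right ht.2).eventuallyLE).trans hlen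
  have heq : ∀ t ∈ Icc (0:ℝ) 1,
      γ t - x = ∫ s in Ioc 0 t, (h s, inner ℝ (J (γ s).1) (h s) / 2) := by
    intro t ht
    rw [H.eq_integral t ht, intervalIntegral.integral_of_le ht.1, add_sub_cancel_left]
    simp only [sum_smul_X]
  have hfst : ∀ t ∈ Icc (0:ℝ) 1, ‖(γ t).1 - x.1‖ ≤ r := by
    intro t ht
    have h1 := congrArg (ContinuousLinearMap.fst ℝ (Hor n) ℝ) (heq t ht)
    rw [← ContinuousLinearMap.integral_comp_comm _ (hsub t ht)] at h1
    simp only [ContinuousLinearMap.coe_fst', Prod.fst_sub] at h1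
    rw [h1]
    exact (norm_integral_le_integral_norm _).trans (hle t ht)
  have hone : (1:ℝ) ∈ Icc (0:ℝ) 1 := by simp
  have hyx : γ 1 = y := H.endpoint
  let l : Heis n →L[ℝ] ℝ := ContinuousLinearMap.snd ℝ (Hor n) ℝ -
    (2:ℝ)⁻¹ • (innerSL ℝ (J x.1)).comp (ContinuousLinearMap.fst ℝ (Hor n) ℝ)
  have hl' : ∀ z : Heis n, l z = z.2 - inner ℝ (J x.1) z.1 / 2 := by
    intro z; simp [l]; ring
  have hsnd : |l (y - x)| ≤ r ^ 2 := by
    rw [← hyx, heq 1 hone, ← ContinuousLinearMap.integral_comp_comm _ hF, ← Real.norm_eq_abs]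
    calc _ ≤ ∫ s in Ioc (0:ℝ) 1, r * ‖h s‖ := by
            refine norm_integral_le_of_norm_le (hh.norm.const_mul r) ?_
            filter_upwards [ae_restrict_mem measurableSet_Ioc] with s hs
            have h1 := abs_inner_J_le ((γ s).1 - x.1) (h s)
            have h2 := mul_le_mul_of_nonneg_right (hfst s (Ioc_subset_Icc_self hs))
              (norm_nonneg (h s))
            have h3 : l (h s, inner ℝ (J (γ s).1) (h s) / 2) =
                inner ℝ (J ((γ s).1 - x.1)) (h s) / 2 := by
              rw [hl', map_sub, inner_sub_left]; ring
            rw [h3, Real.norm_eq_abs, abs_div, abs_two]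
            have h4 := abs_nonneg (inner ℝ (J ((γ s).1 - x.1)) (h s))
            linarith
      _ = r * ∫ s in Ioc (0:ℝ) 1, ‖h s‖ := integral_const_mul _ _
      _ ≤ r ^ 2 := by nlinarith
  -- `l` is the vertical coordinate relative to `x`
  have hl2 : l (y - x) = (mul (-x) y).2 := by
    rw [hl']
    simp only [mul, Prod.fst_sub, Prod.snd_sub, Prod.fst_neg, Prod.snd_neg, map_neg,
      inner_sub_right, inner_neg_left, inner_J_self]
    ring
  refine ⟨?_, ?_⟩
  · rw [Metric.mem_closedBall, dist_zero_right]
    have := hfst 1 hone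
    rw [hyx] at this
    simpa [mul, add_comm, sub_eq_add_neg] using this
  · rw [hl2] at hsnd
    have := abs_le.1 hsnd
    exact ⟨this.1, this.2⟩

lemma hasDerivAt_polynomial (a₁ a₂ a₃ a₄ a₅ a₆ a₇ s : ℝ) :
    HasDerivAt (fun s : ℝ => a₁ * s + a₂ * s ^ 2 + a₃ * s ^ 3 + a₄ * s ^ 4 + a₅ * s ^ 5 +
      a₆ * s ^ 6 + a₇ * s ^ 7) (a₁ + 2 * a₂ * s + 3 * a₃ * s ^ 2 + 4 * a₄ * s ^ 3 +
      5 * a₅ * s ^ 4 + 6 * a₆ * s ^ 5 + 7 * a₇ * s ^ 6) s := by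
  have h := ((((((((hasDerivAt_id s).const_mul a₁).add ((hasDerivAt_pow 2 s).const_mul a₂)).add
    ((hasDerivAt_pow 3 s).const_mul a₃)).add ((hasDerivAt_pow 4 s).const_mul a₄)).add
    ((hasDerivAt_pow 5 s).const_mul a₅)).add ((hasDerivAt_pow 6 s).const_mul a₆)).add
    ((hasDerivAt_pow 7 s).const_mul a₇))
  refine h.congr_deriv ?_
  norm_num
  ring

/-- The left translate of the curve in `ℝ²ⁿ × ℝ` with horizontal part `c` and vertical part `z` is
horizontal as soon as `z' = ⟪J c, c'⟫ / 2`. -/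
lemma isHorizontalCurve_of_hasDerivAt (x : Heis n) {c h : ℝ → Hor n} {z : ℝ → ℝ}
    (hc : ∀ s, HasDerivAt c (h s) s) (hh : Continuous h)
    (hz : ∀ s, HasDerivAt z (inner ℝ (J (c s)) (h s) / 2) s) (hc0 : c 0 = 0) (hz0 : z 0 = 0) :
    IsHorizontalCurve x (mul x (c 1, z 1)) (fun s => mul x (c s, z s)) h := by
  have hd : ∀ s, HasDerivAt (fun s => mul x (c s, z s))
      (∑ i, h s i • X i (mul x (c s, z s))) s := by
    intro s
    rw [sum_smul_X]
    refine ((hc s).const_add x.1).prodMk ?_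
    have h1 := (innerSL ℝ (J x.1)).hasFDerivAt.comp_hasDerivAt s (hc s)
    have h2 := ((hz s).const_add x.2).add (h1.div_const 2)
    refine h2.congr_deriv ?_
    simp only [mul, map_add, inner_add_left, innerSL_apply_apply]
    ring
  have hcont : Continuous fun s => mul x (c s, z s) :=
    continuous_iff_continuousAt.2 fun s => (hd s).continuousAt
  refine ⟨hh.intervalIntegrable _ _, hcont.continuousOn, fun t _ => ?_, rfl⟩
  have hi : Continuous fun s => ∑ i, h s i • X i (mul x (c s, z s)) := by
    have hcc : Continuous c := continuous_iff_continuousAt.2 fun s => (hc s).continuousAt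
    simp only [sum_smul_X, mul]
    fun_prop
  rw [intervalIntegral.integral_eq_sub_of_hasDerivAt (fun s _ => hd s) (hi.intervalIntegrable _ _)]
  simp [hc0, hz0, mul]

/-- The ball-box inclusion from inside. The point `(ξ, τ)` is reached by adding to the segment
`s ξ` a closed loop in the plane of a symplectic pair `e, f`, with coordinates proportional to
`p = s - 3s² + 2s³` and `q = s - 6s² + 10s³ - 5s⁴`. Both have mean zero on `[0, 1]`, which removes
the interaction of loop and segment, and the loop encloses a non-zero area. -/
lemma subset_ccBall (hn : 1 ≤ n) (x : Heis n) {r : ℝ} (hr : 0 < r) :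
    mul (-x) ⁻¹' box n (r / 74) ⊆ ccBall x r := by
  intro y hy
  obtain ⟨ξ, τ, hξτ⟩ : ∃ ξ τ, mul (-x) y = (ξ, τ) := ⟨_, _, rfl⟩
  have hy' : y = mul x (ξ, τ) := by
    rw [← hξτ, ← mul_mul]
    simp [mul]
  rw [mem_preimage, hξτ] at hy
  obtain ⟨h1, h2⟩ := hy
  have hξ : ‖ξ‖ ≤ r / 74 := by simpa using h1
  have hτ : √|τ| ≤ r / 74 :=
    Real.sqrt_le_iff.2 ⟨by positivity, abs_le.2 ⟨by simpa using h2.1, h2.2⟩⟩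
  obtain ⟨a, b, hab, ha, hb⟩ := exists_mul_eq_abs_eq_sqrt τ
  let i : Fin n := ⟨0, hn⟩
  obtain ⟨e, he⟩ : ∃ e : Hor n, e = EuclideanSpace.single (Sum.inl i) 1 := ⟨_, rfl⟩
  obtain ⟨f, hf⟩ : ∃ f : Hor n, f = EuclideanSpace.single (Sum.inr i) 1 := ⟨_, rfl⟩
  have hJef : inner ℝ (J e) f = (1:ℝ) := by simp [he, hf, PiLp.inner_apply]
  have hJfe : inner ℝ (J f) e = (-1:ℝ) := by rw [inner_J_swap, hJef]
  have hne : ‖e‖ = 1 := by simp [he]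
  have hnf : ‖f‖ = 1 := by simp [hf]
  have hp := hasDerivAt_polynomial 1 (-3) 2 0 0 0 0
  have hq := hasDerivAt_polynomial 1 (-6) 10 (-5) 0 0 0
  let A : ℝ := inner ℝ (J ξ) e
  let B : ℝ := inner ℝ (J ξ) f
  have hAe : inner ℝ (J e) ξ = -A := inner_J_swap _ _
  have hBf : inner ℝ (J f) ξ = -B := inner_J_swap _ _
  -- a loop with coordinates `α p`, `b q` rises by `-α b / 70`
  let α : ℝ := -70 * a
  have hc : ∀ s : ℝ, HasDerivAt (fun s : ℝ => s • ξ + (α * (1 * s + -3 * s ^ 2 + 2 * s ^ 3 +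
      0 * s ^ 4 + 0 * s ^ 5 + 0 * s ^ 6 + 0 * s ^ 7)) • e + (b * (1 * s + -6 * s ^ 2 + 10 * s ^ 3 +
      -5 * s ^ 4 + 0 * s ^ 5 + 0 * s ^ 6 + 0 * s ^ 7)) • f)
      (ξ + (α * (1 - 6 * s + 6 * s ^ 2)) • e + (b * (1 - 12 * s + 30 * s ^ 2 - 20 * s ^ 3)) • f)
      s := by
    intro s
    have h0 : HasDerivAt (fun s : ℝ => s • ξ) ξ s := by
      simpa using (hasDerivAt_id s).smul_const ξ
    refine ((h0.add (((hp s).const_mul α).smul_const e)).add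
      (((hq s).const_mul b).smul_const f)).congr_deriv ?_
    ring_nf
  -- the primitive of `⟪J c, c'⟫ / 2`
  have hz := fun s => hasDerivAt_polynomial 0 0
    ((α * A * (-1) + b * B * (-2) - α * b) / 2) ((α * A + b * B * 5 + 4 * (α * b)) / 2)
    ((b * B * (-3) - 33 / 5 * (α * b)) / 2) (5 * (α * b) / 2) (-10 / 7 * (α * b) / 2) s
  have hcurve := isHorizontalCurve_of_hasDerivAt x hc (by fun_prop)
    (fun s => (hz s).congr_deriv (by
      simp only [map_add, map_smul, inner_add_left, inner_add_right, inner_smul_left,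
        inner_smul_right, inner_J_self, hJef, hJfe, hAe, hBf, conj_trivial]
      simp only [A, B]
      ring)) (by simp) (by simp)
  have hend : mul x ((1:ℝ) • ξ + (α * (1 * 1 + -3 * 1 ^ 2 + 2 * 1 ^ 3 +
      0 * 1 ^ 4 + 0 * 1 ^ 5 + 0 * 1 ^ 6 + 0 * 1 ^ 7)) • e + (b * (1 * 1 + -6 * 1 ^ 2 + 10 * 1 ^ 3 +
      -5 * 1 ^ 4 + 0 * 1 ^ 5 + 0 * 1 ^ 6 + 0 * 1 ^ 7)) • f, 0 * 1 + 0 * 1 ^ 2 +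
    ((α * A * (-1) + b * B * (-2) - α * b) / 2) * 1 ^ 3 +
    ((α * A + b * B * 5 + 4 * (α * b)) / 2) * 1 ^ 4 +
    ((b * B * (-3) - 33 / 5 * (α * b)) / 2) * 1 ^ 5 + (5 * (α * b) / 2) * 1 ^ 6 +
    (-10 / 7 * (α * b) / 2) * 1 ^ 7) = y := by
    rw [hy']
    congr 2
    · norm_num
    · simp only [α]
      rw [← hab]; ring
  rw [hend] at hcurve
  have hlen : ∀ s ∈ Icc (0:ℝ) 1, ‖ξ + (α * (1 - 6 * s + 6 * s ^ 2)) • e +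
      (b * (1 - 12 * s + 30 * s ^ 2 - 20 * s ^ 3)) • f‖ ≤ 73 * (r / 74) := by
    intro s hs
    have hp1 : |1 - 6 * s + 6 * s ^ 2| ≤ 1 := by
      rw [abs_le]; constructor <;> nlinarith [sq_nonneg (2 * s - 1), hs.1, hs.2]
    have hq1 : |1 - 12 * s + 30 * s ^ 2 - 20 * s ^ 3| ≤ 2 := by
      have : 1 - 12 * s + 30 * s ^ 2 - 20 * s ^ 3 =
        (1 - 2 * s) * (1 - 10 * (s * (1 - s))) := by ring
      rw [this, abs_mul]
      have e1 : |1 - 2 * s| ≤ 1 := abs_le.2 ⟨by linarith [hs.2], by linarith [hs.1]⟩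
      have e2 : |1 - 10 * (s * (1 - s))| ≤ 2 := by
        have : 0 ≤ s * (1 - s) := mul_nonneg hs.1 (by linarith [hs.2])
        exact abs_le.2 ⟨by nlinarith [sq_nonneg (2 * s - 1)], by linarith⟩
      calc _ ≤ 1 * (2:ℝ) := mul_le_mul e1 e2 (abs_nonneg _) zero_le_one
        _ = 2 := by norm_num
    refine (norm_add_le _ _).trans ((add_le_add_left (norm_add_le _ _) _).trans ?_)
    rw [norm_smul, norm_smul, hne, hnf, Real.norm_eq_abs, Real.norm_eq_abs, abs_mul α, abs_mul b, hb]
    simp only [α]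
    rw [abs_mul, ha]
    have e1 := mul_le_mul (mul_le_mul_of_nonneg_left hτ (abs_nonneg (-70:ℝ))) hp1 (abs_nonneg _)
      (by positivity)
    have e2 := mul_le_mul hτ hq1 (abs_nonneg _) (by positivity)
    have e3 : |(-70:ℝ)| = 70 := by norm_num
    rw [e3] at *
    linarith
  show ccEDist x y < _
  refine lt_of_le_of_lt (b := ENNReal.ofReal (73 * (r / 74)))
    (iInf₂_le_of_le _ _ (iInf_le_of_le hcurve ?_)) ?_
  · calc _ ≤ ∫⁻ s in Icc (0:ℝ) 1, ENNReal.ofReal (73 * (r / 74)) := by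
          refine setLIntegral_mono measurable_const fun s hs => ?_
          rw [← ofReal_norm]
          exact ENNReal.ofReal_le_ofReal (hlen s hs)
      _ = _ := by simp
  · exact (ENNReal.ofReal_lt_ofReal_iff hr).2 (by linarith)

/-! ### Sobolev inequality -/

/-- The `L¹` Poincaré inequality for functions vanishing off a ball: a horizontal translation of
length comparable to the radius makes the support disjoint from itself. -/
lemma lintegral_le_of_support (hn : 1 ≤ n) {φ : Heis n → ℝ} (hφ : ContDiff ℝ 1 φ) {x₀ : Heis n}
    {r : ℝ} (hr : 0 < r) (hs : ∀ x, x ∉ mul (-x₀) ⁻¹' box n r → φ x = 0) :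
    ∫⁻ x, ‖φ x‖ₑ ≤ ENNReal.ofReal (3 * r) * ∫⁻ x, ‖horGrad φ x‖ₑ := by
  obtain ⟨ξ, hξ⟩ : ∃ ξ : Hor n, ‖ξ‖ = 3 * r :=
    ⟨EuclideanSpace.single (Sum.inl ⟨0, hn⟩) (3 * r), by simp [abs_of_pos hr]⟩
  have h := lintegral_translate_horizontal_le hφ ξ
  rw [← ofReal_norm, hξ] at h
  refine le_trans (lintegral_mono fun x => ?_) h
  by_cases hx : φ x = 0
  · simp [hx]
  have hxT : ‖-x₀.1 + x.1‖ ≤ r := by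
    have := (not_imp_comm.1 (hs x) hx).1
    simpa [mul] using this
  have h0 : φ (mul x (ξ, 0)) = 0 := by
    refine hs _ fun hc => ?_
    have h1 : ‖-x₀.1 + (x.1 + ξ)‖ ≤ r := by
      have := hc.1
      simpa [mul] using this
    have h2 : ‖ξ‖ ≤ ‖-x₀.1 + (x.1 + ξ)‖ + ‖-x₀.1 + x.1‖ := by
      refine le_trans (le_of_eq ?_) (norm_sub_le _ _)
      congr 1; abel
    linarith
  simp [h0]

/-- Comparison of a function with its averages over translated boxes of radius `ρ`: the error is of
size `ρ` in `L¹`, and the averages are bounded by the `L¹` norm. -/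
lemma exists_enorm_le_add (hn : 1 ≤ n) {φ : Heis n → ℝ} (hφ : ContDiff ℝ 1 φ) {ρ : ℝ}
    (hρ : 0 < ρ) : ∃ h : Heis n → ℝ≥0∞, Measurable h ∧
      ∫⁻ x, h x ≤ ENNReal.ofReal (5 * ρ) * ∫⁻ x, ‖horGrad φ x‖ₑ ∧
      ∀ x, ‖φ x‖ₑ ≤ h x + (∫⁻ y, ‖φ y‖ₑ) / volume (box n ρ) := by
  set V := volume (box n ρ) with hV
  have hV0 : V ≠ 0 := by
    rw [hV, volume_box hρ.le]
    exact (ENNReal.ofReal_pos.2 (mul_pos boxVol_pos (pow_pos hρ _))).ne'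
  have hVt : V ≠ ⊤ := by rw [hV, volume_box hρ.le]; exact ENNReal.ofReal_ne_top
  have hc : Measurable fun q : Heis n × Heis n => ‖φ (mul q.1 q.2) - φ q.1‖ₑ :=
    ((hφ.continuous.comp continuous_mul).sub (hφ.continuous.comp continuous_fst)).enorm.measurable
  refine ⟨fun x => (∫⁻ y in box n ρ, ‖φ (mul x y) - φ x‖ₑ) / V, ?_, ?_, fun x => ?_⟩
  · exact (Measurable.lintegral_prod_right' hc).div_const V
  · simp only [div_eq_mul_inv]
    rw [lintegral_mul_const _ (Measurable.lintegral_prod_right' hc),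
      lintegral_lintegral_swap hc.aemeasurable, ← div_eq_mul_inv]
    refine ENNReal.div_le_of_le_mul ?_
    calc _ ≤ ∫⁻ _ in box n ρ, ENNReal.ofReal (5 * ρ) * ∫⁻ x, ‖horGrad φ x‖ₑ := by
          refine setLIntegral_mono measurable_const fun y hy => ?_
          refine (lintegral_translate_le hn hφ y).trans ?_
          gcongr
          have h1 : ‖y.1‖ ≤ ρ := by simpa using hy.1
          have h2 : √|y.2| ≤ ρ :=
            Real.sqrt_le_iff.2 ⟨hρ.le, abs_le.2 ⟨by simpa using hy.2.1, hy.2.2⟩⟩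
          linarith
      _ = _ := by simp [hV]
  · rw [← ENNReal.add_div, ENNReal.le_div_iff_mul_le (Or.inl hV0) (Or.inl hVt)]
    have htri : ∀ u v : ℝ, ‖u‖ₑ ≤ ‖v - u‖ₑ + ‖v‖ₑ := fun u v => by
      have h := enorm_sub_le (a := v) (b := v - u)
      rwa [sub_sub_cancel, add_comm] at h
    have h1 : ‖φ x‖ₑ * V = ∫⁻ _ in box n ρ, ‖φ x‖ₑ := by rw [setLIntegral_const]
    rw [h1]
    refine (lintegral_mono fun y => htri (φ x) (φ (mul x y))).trans ?_
    have hcx : Measurable fun y => ‖φ (mul x y) - φ x‖ₑ :=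
      ((hφ.continuous.comp (continuous_mul_left x)).sub continuous_const).enorm.measurable
    rw [lintegral_add_left hcx]
    refine add_le_add le_rfl ((setLIntegral_le_lintegral _ _).trans_eq ?_)
    exact (measurePreserving_mul_left x).lintegral_comp hφ.continuous.enorm.measurable

/-- The weak-type Sobolev inequality with exponent `1 + 1 / Q`, in scaled form. -/
lemma volume_lt_enorm_le (hn : 1 ≤ n) {φ : Heis n → ℝ} (hφ : ContDiff ℝ 1 φ) {x₀ : Heis n}
    {r k t : ℝ} (hr : 0 < r) (hk : 0 < k) (ht : 0 < t)
    (hs : ∀ x, x ∉ mul (-x₀) ⁻¹' box n r → φ x = 0)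
    (hI : ∫⁻ x, ‖horGrad φ x‖ₑ ≤ ENNReal.ofReal (2 * k * r ^ (homDim n - 1))) :
    volume {x | (6 / boxVol n + 1) * k * t < |φ x|} ≤
      ENNReal.ofReal (10 * r ^ homDim n * t ^ (-1 - 1 / (homDim n : ℝ))) := by
  have hω := boxVol_pos (n := n)
  have hQ : (homDim n : ℝ) ≠ 0 := by simp [homDim]; positivity
  have hr1 : r * r ^ (homDim n - 1) = r ^ homDim n := by
    rw [mul_comm]; exact pow_sub_one_mul (by simp [homDim]) r
  -- the averages at this scale are bounded by a multiple of `k * t`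
  set ρ : ℝ := r * t ^ (-1 / (homDim n : ℝ)) with hρdef
  have hρ : 0 < ρ := by positivity
  have hρQ : ρ ^ homDim n = r ^ homDim n / t := by
    rw [hρdef, mul_pow, ← Real.rpow_natCast (t ^ _), ← Real.rpow_mul ht.le, div_mul_cancel₀ _ hQ,
      Real.rpow_neg_one, div_eq_mul_inv]
  obtain ⟨h, hm, hint, hle⟩ := exists_enorm_le_add hn hφ hρ
  have hmean : (∫⁻ y, ‖φ y‖ₑ) / volume (box n ρ) ≤ ENNReal.ofReal (6 / boxVol n * k * t) := by
    rw [volume_box hρ.le]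
    refine ENNReal.div_le_of_le_mul ?_
    refine ((lintegral_le_of_support hn hφ hr hs).trans (mul_le_mul_right hI _)).trans ?_
    rw [← ENNReal.ofReal_mul (by positivity), ← ENNReal.ofReal_mul (by positivity), hρQ]
    refine ENNReal.ofReal_le_ofReal (le_of_eq ?_)
    rw [← hr1]
    field_simp
    norm_num
  have hsub : {x | (6 / boxVol n + 1) * k * t < |φ x|} ⊆ {x | ENNReal.ofReal (k * t) ≤ h x} := by
    intro x hx
    by_contra hc
    have h1 : h x < ENNReal.ofReal (k * t) := not_le.1 hc
    have h2 : ENNReal.ofReal ((6 / boxVol n + 1) * k * t) < ‖φ x‖ₑ := by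
      rw [Real.enorm_eq_ofReal_abs]
      exact (ENNReal.ofReal_lt_ofReal_iff_of_nonneg (by positivity)).2 hx
    have h3 := (hle x).trans (add_le_add h1.le hmean)
    rw [← ENNReal.ofReal_add (by positivity) (by positivity)] at h3
    refine (h2.trans_le h3).ne ?_
    congr 1; ring
  refine (measure_mono hsub).trans ((meas_ge_le_lintegral_div hm.aemeasurable
    (ENNReal.ofReal_pos.2 (by positivity)).ne' ENNReal.ofReal_ne_top).trans ?_)
  refine ENNReal.div_le_of_le_mul ((hint.trans (mul_le_mul_right hI _)).trans ?_)
  rw [← ENNReal.ofReal_mul (by positivity), ← ENNReal.ofReal_mul (by positivity)]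
  refine ENNReal.ofReal_le_ofReal (le_of_eq ?_)
  have ht1 : t ^ (-1 - 1 / (homDim n : ℝ)) * t = t ^ (-1 / (homDim n : ℝ)) := by
    conv_lhs => rw [← Real.rpow_one t, ← Real.rpow_mul ht.le, ← Real.rpow_add ht]
    congr 1; ring
  rw [hρdef, ← hr1, ← ht1]
  ring

/-- An exponent strictly between `1` and the weak-type exponent `1 + 1 / Q`. -/
def sobolevExp (n : ℕ) : ℝ := 1 + 1 / (2 * homDim n)

lemma one_lt_sobolevExp : 1 < sobolevExp n := by
  have : (0:ℝ) < homDim n := by simp [homDim]; positivity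
  have : (0:ℝ) < 1 / (2 * homDim n) := by positivity
  unfold sobolevExp; linarith

/-- The strong-type Sobolev inequality below the exponent `1 + 1 / Q`, in scaled form. -/
lemma lintegral_rpow_le (hn : 1 ≤ n) {φ : Heis n → ℝ} (hφ : ContDiff ℝ 1 φ) {x₀ : Heis n}
    {r k : ℝ} (hr : 0 < r) (hk : 0 < k) (hs : ∀ x, x ∉ mul (-x₀) ⁻¹' box n r → φ x = 0)
    (hI : ∫⁻ x, ‖horGrad φ x‖ₑ ≤ ENNReal.ofReal (2 * k * r ^ (homDim n - 1))) :
    ∫⁻ x in mul (-x₀) ⁻¹' box n r,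
        ENNReal.ofReal ((|φ x| / ((6 / boxVol n + 1) * k)) ^ sobolevExp n) ≤
      ENNReal.ofReal (sobolevExp n * (boxVol n + 20 * homDim n) * r ^ homDim n) := by
  have hω := boxVol_pos (n := n)
  have hγ := one_lt_sobolevExp (n := n)
  have hQ : (0:ℝ) < homDim n := by simp [homDim]; positivity
  set c : ℝ := (6 / boxVol n + 1) * k with hc
  have hc0 : 0 < c := by positivity
  set T := mul (-x₀) ⁻¹' box n r
  have hT : volume T = ENNReal.ofReal (boxVol n * r ^ homDim n) := volume_translate_box _ hr.le
  rw [lintegral_rpow_eq_lintegral_meas_lt_mul _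
    (Filter.Eventually.of_forall fun x => by positivity)
    (hφ.continuous.abs.div_const c).aemeasurable (by linarith)]
  have hbig : ∀ t ∈ Ioi (1:ℝ), volume.restrict T {x | t < |φ x| / c} *
      ENNReal.ofReal (t ^ (sobolevExp n - 1)) ≤
      ENNReal.ofReal (10 * r ^ homDim n * t ^ (-1 - 1 / (2 * homDim n) : ℝ)) := by
    intro t ht
    have ht0 : (0:ℝ) < t := zero_lt_one.trans ht
    have h1 : volume.restrict T {x | t < |φ x| / c} ≤
        ENNReal.ofReal (10 * r ^ homDim n * t ^ (-1 - 1 / (homDim n : ℝ))) := by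
      refine (Measure.restrict_apply_le _ _).trans
        (le_trans (le_of_eq ?_) (volume_lt_enorm_le hn hφ hr hk ht0 hs hI))
      congr 1
      ext x
      rw [Set.mem_ofPred_eq, Set.mem_ofPred_eq, lt_div_iff₀ hc0, mul_comm]
    refine (mul_le_mul_left h1 _).trans ?_
    rw [← ENNReal.ofReal_mul (by positivity), mul_assoc, ← Real.rpow_add ht0]
    refine le_of_eq ?_
    congr 3
    simp only [sobolevExp]
    field_simp
    ring
  have hsmall : ∀ t ∈ Ioc (0:ℝ) 1, volume.restrict T {x | t < |φ x| / c} *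
      ENNReal.ofReal (t ^ (sobolevExp n - 1)) ≤ ENNReal.ofReal (boxVol n * r ^ homDim n) := by
    intro t ht
    rw [← hT, ← mul_one (volume T)]
    refine mul_le_mul' ?_ ?_
    · exact (measure_mono (subset_univ _)).trans_eq (Measure.restrict_apply_univ T)
    · rw [← ENNReal.ofReal_one]
      exact ENNReal.ofReal_le_ofReal (Real.rpow_le_one ht.1.le ht.2 (by linarith))
  have htail : ∫⁻ t in Ioi (1:ℝ),
      ENNReal.ofReal (10 * r ^ homDim n * t ^ (-1 - 1 / (2 * homDim n) : ℝ)) =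
      ENNReal.ofReal (20 * homDim n * r ^ homDim n) := by
    have he : (-1 - 1 / (2 * homDim n) : ℝ) < -1 := by
      have : (0:ℝ) < 1 / (2 * homDim n) := by positivity
      linarith
    rw [← ofReal_integral_eq_lintegral_ofReal
      ((integrableOn_Ioi_rpow_of_lt he zero_lt_one).const_mul _)]
    · rw [integral_const_mul, integral_Ioi_rpow_of_lt he zero_lt_one]
      congr 1
      rw [Real.one_rpow]
      field_simp
      ring
    · filter_upwards [ae_restrict_mem measurableSet_Ioi] with t ht
      have : (0:ℝ) < t := zero_lt_one.trans ht
      positivity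
  rw [mul_assoc, ENNReal.ofReal_mul (by linarith : 0 ≤ sobolevExp n), add_mul,
    ENNReal.ofReal_add (by positivity) (by positivity)]
  refine mul_le_mul_right ?_ _
  rw [← Ioc_union_Ioi_eq_Ioi (zero_le_one (α := ℝ)),
    lintegral_union measurableSet_Ioi (Ioc_disjoint_Ioi le_rfl)]
  refine add_le_add ?_ ?_
  · refine (setLIntegral_mono measurable_const hsmall).trans_eq ?_
    simp
  · rw [← htail]
    exact setLIntegral_mono (by fun_prop) hbig

/-- The Sobolev inequality in the form used for the test function: with `k` the natural scale of
`φ`, the function `(1 + (φ / k)²)^{γ/2}` is bounded on average. -/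
lemma exists_lintegral_one_add_sq_rpow_le (hn : 1 ≤ n) : ∃ C : ℝ, 0 < C ∧
    ∀ (φ : Heis n → ℝ) (x₀ : Heis n) (r k : ℝ), ContDiff ℝ 1 φ → 0 < r → 0 < k →
      (∀ x, x ∉ mul (-x₀) ⁻¹' box n r → φ x = 0) →
      ∫⁻ x, ‖horGrad φ x‖ₑ ≤ ENNReal.ofReal (2 * k * r ^ (homDim n - 1)) →
      ∫⁻ x in mul (-x₀) ⁻¹' box n r, ENNReal.ofReal ((1 + (φ x / k) ^ 2) ^ (sobolevExp n / 2)) ≤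
        ENNReal.ofReal (C * r ^ homDim n) := by
  have hω := boxVol_pos (n := n)
  have hγ := one_lt_sobolevExp (n := n)
  set γ := sobolevExp n
  set c : ℝ := 6 / boxVol n + 1 with hc
  have hc0 : 0 < c := by positivity
  refine ⟨2 ^ γ * (boxVol n + c ^ γ * (γ * (boxVol n + 20 * homDim n))), by positivity, ?_⟩
  intro φ x₀ r k hφ hr hk hs hI
  have hpt : ∀ x, ENNReal.ofReal ((1 + (φ x / k) ^ 2) ^ (γ / 2)) ≤
      ENNReal.ofReal (2 ^ γ) *
        (1 + ENNReal.ofReal (c ^ γ) * ENNReal.ofReal ((|φ x| / (c * k)) ^ γ)) := by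
    intro x
    set y : ℝ := |φ x| / k with hy
    have hy0 : 0 ≤ y := by positivity
    have h1 : (φ x / k) ^ 2 = y ^ 2 := by rw [hy, div_pow, div_pow, sq_abs]
    have h2 : |φ x| / (c * k) = y / c := by rw [hy, div_div, mul_comm c]
    rw [← ENNReal.ofReal_mul (by positivity), ← ENNReal.ofReal_one,
      ← ENNReal.ofReal_add (by positivity) (by positivity), ← ENNReal.ofReal_mul (by positivity)]
    refine ENNReal.ofReal_le_ofReal ?_
    rw [h1, h2, Real.div_rpow hy0 hc0.le, mul_div_cancel₀ _ (by positivity)]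
    calc (1 + y ^ 2) ^ (γ / 2) ≤ ((2 * max 1 y) ^ 2) ^ (γ / 2) := by
          refine Real.rpow_le_rpow (by positivity) ?_ (by linarith)
          nlinarith [le_max_left 1 y, le_max_right 1 y]
      _ = (2 * max 1 y) ^ γ := by
          rw [← Real.rpow_natCast, ← Real.rpow_mul (by positivity)]
          congr 1; push_cast; ring
      _ = 2 ^ γ * (max 1 y) ^ γ := Real.mul_rpow (by norm_num) (by positivity)
      _ ≤ 2 ^ γ * (1 + y ^ γ) := by
          refine mul_le_mul_of_nonneg_left ?_ (by positivity)
          rcases max_cases 1 y with h | h <;> rw [h.1]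
          · rw [Real.one_rpow]; linarith [Real.rpow_nonneg hy0 γ]
          · linarith
  have hm : Measurable fun x => ENNReal.ofReal (c ^ γ) * ENNReal.ofReal ((|φ x| / (c * k)) ^ γ) :=
    (((hφ.continuous.abs.div_const _).rpow_const fun _ =>
      Or.inr (by linarith)).measurable.ennreal_ofReal).const_mul _
  refine (lintegral_mono hpt).trans ?_
  rw [lintegral_const_mul _ (hm.const_add _), lintegral_add_left measurable_const,
    lintegral_const_mul' _ _ ENNReal.ofReal_ne_top, lintegral_const, Measure.restrict_apply_univ,
    volume_translate_box _ hr.le, one_mul]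
  refine (mul_le_mul_right (add_le_add_right (mul_le_mul_right
    (lintegral_rpow_le hn hφ hr hk hs hI) _) _) _).trans_eq ?_
  rw [← ENNReal.ofReal_mul (by positivity), ← ENNReal.ofReal_add (by positivity) (by positivity),
    ← ENNReal.ofReal_mul (by positivity)]
  congr 1
  ring

/-! ### Monotonicity and growth of the vector field -/

/-- A symmetric operator whose quadratic form lies between `0` and `Λ` has norm at most `Λ`. -/
lemma norm_apply_le_of_symm {E : Type*} [NormedAddCommGroup E] [InnerProductSpace ℝ E]
    (A : E →L[ℝ] E) {Λ : ℝ} (hsymm : ∀ ξ η, inner ℝ (A ξ) η = inner ℝ ξ (A η))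
    (h0 : ∀ ξ, 0 ≤ inner ℝ (A ξ) ξ) (hΛ : ∀ ξ, inner ℝ (A ξ) ξ ≤ Λ * ‖ξ‖ ^ 2) (ξ : E) :
    ‖A ξ‖ ≤ Λ * ‖ξ‖ := by
  by_cases hA : A ξ = 0
  · by_cases hξ : ξ = 0
    · simp [hξ]
    · have h1 := (h0 ξ).trans (hΛ ξ)
      have h2 : 0 < ‖ξ‖ := norm_pos_iff.2 hξ
      rw [hA, norm_zero]
      have : 0 ≤ Λ * ‖ξ‖ * ‖ξ‖ := by nlinarith
      exact nonneg_of_mul_nonneg_left this h2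
  have hξ : 0 < ‖ξ‖ := by
    refine norm_pos_iff.2 fun h => hA ?_
    rw [h, map_zero]
  have hA' : 0 < ‖A ξ‖ := norm_pos_iff.2 hA
  set η : E := (‖ξ‖ / ‖A ξ‖) • A ξ with hη
  have hnη : ‖η‖ = ‖ξ‖ := by
    rw [hη, norm_smul, Real.norm_eq_abs, abs_of_pos (by positivity)]
    field_simp
  have hin : inner ℝ (A ξ) η = ‖ξ‖ * ‖A ξ‖ := by
    rw [hη, inner_smul_right, real_inner_self_eq_norm_sq]
    field_simp
  have hpol : inner ℝ (A (ξ + η)) (ξ + η) - inner ℝ (A (ξ - η)) (ξ - η) =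
      4 * inner ℝ (A ξ) η := by
    have h1 : inner ℝ (A η) ξ = inner ℝ (A ξ) η := by
      rw [hsymm, real_inner_comm]
    simp only [map_add, map_sub, inner_add_left, inner_add_right, inner_sub_left, inner_sub_right,
      h1]
    ring
  have h1 := hΛ (ξ + η)
  have h2 := h0 (ξ - η)
  have h3 : ‖ξ + η‖ ≤ 2 * ‖ξ‖ := (norm_add_le _ _).trans (by rw [hnη]; linarith)
  have hΛ0 : 0 ≤ Λ := by
    have := (h0 ξ).trans (hΛ ξ)
    exact nonneg_of_mul_nonneg_left this (by positivity)
  have h4 : Λ * ‖ξ + η‖ ^ 2 ≤ Λ * (2 * ‖ξ‖) ^ 2 := by gcongr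
  have h5 : ‖A ξ‖ * ‖ξ‖ ≤ Λ * ‖ξ‖ * ‖ξ‖ := by nlinarith
  exact le_of_mul_le_mul_right h5 hξ

namespace StructureCondition

variable {p L L' s α : ℝ} {Ω : Set (Heis n)} {a : Heis n → Hor n → Hor n}

/-- Strong monotonicity of the vector field: on one of the two outer quarters of the segment from
`z₂` to `z₁`, every point has norm at least `‖z₁ - z₂‖ / 4`. -/
lemma le_inner (ha : StructureCondition p L L' s α Ω a) (hp : 2 ≤ p) {x : Heis n}
    (hx : x ∈ Ω) (z₁ z₂ : Hor n) :
    (1 / 4) ^ (p - 1) * ‖z₁ - z₂‖ ^ p ≤ inner ℝ (a x z₁ - a x z₂) (z₁ - z₂) := by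
  set ζ := z₁ - z₂ with hζ
  by_cases hζ0 : ζ = 0
  · rw [hζ0, norm_zero, Real.zero_rpow (by linarith), inner_zero_right, mul_zero]
  have hζp : 0 < ‖ζ‖ := norm_pos_iff.2 hζ0
  let g : ℝ → ℝ := fun t => inner ℝ (a x (z₂ + t • ζ)) ζ
  have hd : ∀ t, HasDerivAt g (inner ℝ (fderiv ℝ (a x) (z₂ + t • ζ) ζ) ζ) t := by
    intro t
    have h1 : HasDerivAt (fun t : ℝ => z₂ + t • ζ) ζ t := by
      simpa using ((hasDerivAt_id t).smul_const ζ).const_add z₂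
    have h2 := (((ha.contDiff x hx).differentiable one_ne_zero)
      (z₂ + t • ζ)).hasFDerivAt.comp_hasDerivAt t h1
    simpa using h2.inner ℝ (hasDerivAt_const t ζ)
  have hlow : ∀ t, (‖z₂ + t • ζ‖ ^ 2 + s ^ 2) ^ ((p - 2) / 2) * ‖ζ‖ ^ 2 ≤ deriv g t := fun t => by
    rw [(hd t).deriv]; exact ha.lower x hx _ ζ
  have hmono : Monotone g := monotone_of_deriv_nonneg (fun t => (hd t).differentiableAt)
    fun t => le_trans (by positivity) (hlow t)
  set m : ℝ := (‖ζ‖ / 4) ^ (p - 2) * ‖ζ‖ ^ 2 with hm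
  have hbig : ∀ t, ‖ζ‖ / 4 ≤ ‖z₂ + t • ζ‖ → m ≤ deriv g t := by
    intro t ht
    refine le_trans ?_ (hlow t)
    refine mul_le_mul_of_nonneg_right ?_ (by positivity)
    have : (‖ζ‖ / 4) ^ (p - 2) = ((‖ζ‖ / 4) ^ 2) ^ ((p - 2) / 2) := by
      rw [← Real.rpow_natCast, ← Real.rpow_mul (by positivity)]
      congr 1; push_cast; ring
    rw [this]
    refine Real.rpow_le_rpow (by positivity) ?_ (by linarith)
    have : (‖ζ‖ / 4) ^ 2 ≤ ‖z₂ + t • ζ‖ ^ 2 := by gcongr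
    nlinarith [sq_nonneg s]
  have hmvt : ∀ u v : ℝ, u ≤ v → (∀ t ∈ Icc u v, ‖ζ‖ / 4 ≤ ‖z₂ + t • ζ‖) →
      m * (v - u) ≤ g v - g u := by
    intro u v huv h
    refine (convex_Icc u v).mul_sub_le_image_sub_of_le_deriv
      (fun t _ => (hd t).continuousAt.continuousWithinAt)
      (fun t _ => (hd t).differentiableAt.differentiableWithinAt)
      (fun t ht => hbig t (h t (interior_subset ht))) u (left_mem_Icc.2 huv) v
      (right_mem_Icc.2 huv) huv
  have hfin : m * (1 / 4) ≤ g 1 - g 0 := by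
    by_cases hc : ∀ t ∈ Icc (0:ℝ) (1 / 4), ‖ζ‖ / 4 ≤ ‖z₂ + t • ζ‖
    · have h1 := hmvt 0 (1 / 4) (by norm_num) hc
      have h2 := hmono (show (1 / 4 : ℝ) ≤ 1 by norm_num)
      linarith
    · push Not at hc
      obtain ⟨t, ht, hlt⟩ := hc
      have h1 := hmvt (3 / 4) 1 (by norm_num) fun u hu => by
        have h3 : ‖(u - t) • ζ‖ ≤ ‖z₂ + u • ζ‖ + ‖z₂ + t • ζ‖ := by
          refine le_trans (le_of_eq ?_) (norm_sub_le _ _)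
          congr 1; module
        rw [norm_smul, Real.norm_eq_abs, abs_of_nonneg (by linarith [hu.1, ht.2])] at h3
        have h4 : 1 / 2 * ‖ζ‖ ≤ (u - t) * ‖ζ‖ :=
          mul_le_mul_of_nonneg_right (by linarith [hu.1, ht.2]) hζp.le
        linarith
      have h2 := hmono (show (0 : ℝ) ≤ 3 / 4 by norm_num)
      linarith
  have e1 : g 1 - g 0 = inner ℝ (a x z₁ - a x z₂) ζ := by
    simp [g, inner_sub_left, hζ]
  rw [← e1]
  refine le_trans (le_of_eq ?_) hfin
  have h4 : ((1:ℝ) / 4) ^ (p - 1) = (1 / 4) ^ (p - 2) * (1 / 4) := by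
    rw [← Real.rpow_add_one (by norm_num)]; congr 1; ring
  have h5 : ‖ζ‖ ^ p = ‖ζ‖ ^ (p - 2) * ‖ζ‖ ^ 2 := by
    rw [← Real.rpow_natCast, ← Real.rpow_add hζp]; congr 1; push_cast; ring
  rw [hm, div_eq_mul_one_div ‖ζ‖, Real.mul_rpow hζp.le (by norm_num), h4, h5]
  ring

lemma norm_sub_le (ha : StructureCondition p L L' s α Ω a) (hp : 2 ≤ p) (hL : 1 ≤ L) (hs : 0 ≤ s)
    {x : Heis n} (hx : x ∈ Ω) (z₁ z₂ : Hor n) :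
    ‖a x z₁ - a x z₂‖ ≤ L * (‖z₁‖ + ‖z₂‖ + s) ^ (p - 1) := by
  set H := ‖z₁‖ + ‖z₂‖ + s with hH
  have hH0 : 0 ≤ H := by positivity
  have h1 : ‖a x z₁ - a x z₂‖ ≤ L * H ^ (p - 2) * ‖z₁ - z₂‖ := by
    refine (convex_closedBall (0 : Hor n) (‖z₁‖ + ‖z₂‖)).norm_image_sub_le_of_norm_fderiv_le
      (fun z _ => ((ha.contDiff x hx).differentiable one_ne_zero) z) (fun z hz => ?_)
      (by simp) (by simp)
    have hz' : ‖z‖ ≤ ‖z₁‖ + ‖z₂‖ := by simpa using hz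
    refine ContinuousLinearMap.opNorm_le_bound _ (by positivity) fun ξ => ?_
    refine (norm_apply_le_of_symm _ (ha.symm x hx z)
      (fun ξ => le_trans (by positivity) (ha.lower x hx z ξ)) (ha.upper x hx z) ξ).trans ?_
    gcongr
    have : H ^ (p - 2) = (H ^ 2) ^ ((p - 2) / 2) := by
      rw [← Real.rpow_natCast, ← Real.rpow_mul hH0]
      congr 1; push_cast; ring
    rw [this]
    refine Real.rpow_le_rpow (by positivity) ?_ (by linarith)
    nlinarith [norm_nonneg z, mul_nonneg (norm_nonneg z) hs]
  have h2 : ‖z₁ - z₂‖ ≤ H := (_root_.norm_sub_le _ _).trans (by linarith)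
  rcases hH0.eq_or_lt with h0 | h0
  · have h3 : ‖z₁ - z₂‖ = 0 := le_antisymm (h2.trans h0.ge) (norm_nonneg _)
    rw [h3, mul_zero] at h1
    exact h1.trans (by positivity)
  · have h3 : H ^ (p - 1) = H ^ (p - 2) * H := by
      rw [← Real.rpow_add_one h0.ne']; congr 1; ring
    rw [h3]
    calc _ ≤ _ := h1
      _ ≤ L * H ^ (p - 2) * H := by gcongr
      _ = _ := by ring

end StructureCondition

/-! ### Integrability of the vector field -/

lemma ae_restrict_mem_of_subset {Ω B : Set (Heis n)} (hΩ : IsOpen Ω) (hB : B ⊆ Ω) :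
    ∀ᵐ x ∂(volume.restrict B), x ∈ Ω :=
  ae_mono (Measure.restrict_mono_set _ hB) (ae_restrict_mem hΩ.measurableSet)

namespace StructureCondition

variable {p L L' s α : ℝ} {Ω B : Set (Heis n)} {a : Heis n → Hor n → Hor n}

lemma aestronglyMeasurable_comp (ha : StructureCondition p L L' s α Ω a) (hΩ : IsOpen Ω)
    (hB : B ⊆ Ω) {g : Heis n → Hor n} (hg : AEStronglyMeasurable g (volume.restrict B)) :
    AEStronglyMeasurable (fun x => a x (g x)) (volume.restrict B) := by
  classical
  have hF : Measurable ((Ω ×ˢ (univ : Set (Hor n))).piecewise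
      (fun q : Heis n × Hor n => a q.1 q.2) 0) :=
    ha.continuousOn.measurable_piecewise continuousOn_const
      (hΩ.measurableSet.prod MeasurableSet.univ)
  have h1 := (hF.comp_aemeasurable (aemeasurable_id.prodMk hg.aemeasurable)).aestronglyMeasurable
  refine h1.congr ?_
  filter_upwards [ae_restrict_mem_of_subset hΩ hB] with x hx
  simp [hx]

/-- If `z₁`, `z₂` are in `L^p`, then `a(x, z₁) - a(x, z₂)` is in the dual space `L^{p/(p-1)}`. -/
lemma memLp_sub (ha : StructureCondition p L L' s α Ω a) (hp : 2 ≤ p) (hL : 1 ≤ L) (hs : 0 ≤ s)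
    (hΩ : IsOpen Ω) (hB : B ⊆ Ω) (hBf : volume B ≠ ⊤) {z₁ z₂ : Heis n → Hor n}
    (h₁ : MemLp z₁ (ENNReal.ofReal p) (volume.restrict B))
    (h₂ : MemLp z₂ (ENNReal.ofReal p) (volume.restrict B)) :
    MemLp (fun x => a x (z₁ x) - a x (z₂ x)) (ENNReal.ofReal (p / (p - 1)))
      (volume.restrict B) := by
  have : IsFiniteMeasure (volume.restrict B) := ⟨by
    rw [Measure.restrict_apply_univ]; exact hBf.lt_top⟩
  have hH : MemLp (fun x => ‖z₁ x‖ + ‖z₂ x‖ + s) (ENNReal.ofReal p) (volume.restrict B) :=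
    (h₁.norm.add h₂.norm).add (memLp_const s)
  have h3 := (hH.norm_rpow_div (ENNReal.ofReal (p - 1))).const_mul L
  rw [ENNReal.toReal_ofReal (by linarith), ← ENNReal.ofReal_div_of_pos (by linarith)] at h3
  refine h3.mono' ((ha.aestronglyMeasurable_comp hΩ hB h₁.1).sub
    (ha.aestronglyMeasurable_comp hΩ hB h₂.1)) ?_
  filter_upwards [ae_restrict_mem_of_subset hΩ hB] with x hx
  rw [Real.norm_of_nonneg (by positivity : 0 ≤ ‖z₁ x‖ + ‖z₂ x‖ + s)]
  exact ha.norm_sub_le hp hL hs hx _ _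

end StructureCondition

lemma holderTriple_conj {p : ℝ} (hp : 2 ≤ p) :
    ENNReal.HolderTriple (ENNReal.ofReal (p / (p - 1))) (ENNReal.ofReal p) 1 := by
  refine ⟨?_⟩
  have h0 : 0 < p - 1 := by linarith
  have h1 : 0 < p := by linarith
  rw [← ENNReal.ofReal_inv_of_pos (by positivity), ← ENNReal.ofReal_inv_of_pos h1,
    ← ENNReal.ofReal_add (by positivity) (by positivity), inv_one, ← ENNReal.ofReal_one]
  congr 1
  field_simp
  ring

lemma eLpNorm_inner_le {p : ℝ} (hp : 2 ≤ p) {ν : Measure (Heis n)} {D e : Heis n → Hor n}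
    (hD : MemLp D (ENNReal.ofReal (p / (p - 1))) ν) (he : MemLp e (ENNReal.ofReal p) ν) :
    eLpNorm (fun x => inner ℝ (D x) (e x)) 1 ν ≤
      eLpNorm D (ENNReal.ofReal (p / (p - 1))) ν * eLpNorm e (ENNReal.ofReal p) ν := by
  have := holderTriple_conj hp
  have := eLpNorm_le_eLpNorm_mul_eLpNorm'_of_norm (p := ENNReal.ofReal (p / (p - 1)))
    (q := ENNReal.ofReal p) (r := 1) hD.1 he.1 (fun u v => inner ℝ u v) 1
    (Filter.Eventually.of_forall fun x => by simpa using norm_inner_le_norm (𝕜 := ℝ) (D x) (e x))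
  simpa using this

lemma integrable_inner {p : ℝ} (hp : 2 ≤ p) {ν : Measure (Heis n)} {D e : Heis n → Hor n}
    (hD : MemLp D (ENNReal.ofReal (p / (p - 1))) ν) (he : MemLp e (ENNReal.ofReal p) ν) :
    Integrable (fun x => inner ℝ (D x) (e x)) ν :=
  memLp_one_iff_integrable.1 ⟨hD.1.inner he.1,
    (eLpNorm_inner_le hp hD he).trans_lt (ENNReal.mul_lt_top hD.2 he.2)⟩

/-! ### The bounded test function -/

/-- The weight `(1 + t²)^{-γ/2}`, integrable on the line for `γ > 1`. -/
def weight (γ t : ℝ) : ℝ := (1 + t ^ 2) ^ (-γ / 2)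

/-- The primitive of `weight` vanishing at `0`. -/
def weightPrim (γ t : ℝ) : ℝ := ∫ u in (0:ℝ)..t, weight γ u

lemma weight_pos (γ t : ℝ) : 0 < weight γ t := by unfold weight; positivity

lemma weight_le_one {γ : ℝ} (hγ : 0 ≤ γ) (t : ℝ) : weight γ t ≤ 1 :=
  Real.rpow_le_one_of_one_le_of_nonpos (by nlinarith [sq_nonneg t]) (by linarith)

lemma contDiff_weight (γ : ℝ) : ContDiff ℝ ∞ (weight γ) := by
  unfold weight
  refine ContDiff.rpow_const_of_ne (by fun_prop) fun t => by positivity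

lemma hasDerivAt_weightPrim (γ t : ℝ) : HasDerivAt (weightPrim γ) (weight γ t) t :=
  intervalIntegral.integral_hasDerivAt_right
    ((contDiff_weight γ).continuous.intervalIntegrable _ _)
    ((contDiff_weight γ).continuous.stronglyMeasurableAtFilter _ _)
    (contDiff_weight γ).continuous.continuousAt

lemma contDiff_weightPrim (γ : ℝ) : ContDiff ℝ ∞ (weightPrim γ) := by
  refine contDiff_infty_iff_deriv.2
    ⟨fun t => (hasDerivAt_weightPrim γ t).differentiableAt, ?_⟩
  rw [show deriv (weightPrim γ) = weight γ from funext fun t => (hasDerivAt_weightPrim γ t).deriv]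
  exact contDiff_weight γ

lemma exists_abs_weightPrim_le {γ : ℝ} (hγ : 1 < γ) :
    ∃ C : ℝ, 0 < C ∧ ∀ t, |weightPrim γ t| ≤ C := by
  have hi : Integrable (weight γ) := by
    have := integrable_rpow_neg_one_add_norm_sq (E := ℝ) (μ := volume) (r := γ) (by simpa using hγ)
    simp only [Real.norm_eq_abs, sq_abs] at this
    exact this
  refine ⟨(∫ t, weight γ t) + 1, ?_, fun t => ?_⟩
  · have : 0 ≤ ∫ t, weight γ t := integral_nonneg fun t => (weight_pos γ t).le
    exact add_pos_of_nonneg_of_pos this one_pos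
  · refine le_trans ?_ (le_add_of_nonneg_right zero_le_one)
    rw [weightPrim, ← Real.norm_eq_abs, intervalIntegral.norm_intervalIntegral_eq]
    refine (norm_integral_le_integral_norm _).trans ?_
    simp only [Real.norm_of_nonneg (weight_pos γ _).le]
    exact setIntegral_le_integral hi (Filter.Eventually.of_forall fun t => (weight_pos γ t).le)

/-! ### Test functions and the tested equation -/

lemma IsTest.eq_zero {U : Set (Heis n)} {φ : Heis n → ℝ} (h : IsTest U φ) {x : Heis n}
    (hx : x ∉ U) : φ x = 0 :=
  image_eq_zero_of_notMem_tsupport fun hc => hx (h.support hc)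

lemma IsTest.horGrad_eq_zero {U : Set (Heis n)} {φ : Heis n → ℝ} (h : IsTest U φ) {x : Heis n}
    (hx : x ∉ U) : horGrad φ x = 0 :=
  Heisenberg.horGrad_eq_zero fun hc => hx (h.support hc)

lemma IsTest.mono {U V : Set (Heis n)} {φ : Heis n → ℝ} (h : IsTest U φ) (hUV : U ⊆ V) :
    IsTest V φ := ⟨h.smooth, h.compact, h.support.trans hUV⟩

lemma IsTest.contDiff_one {U : Set (Heis n)} {φ : Heis n → ℝ} (h : IsTest U φ) :
    ContDiff ℝ 1 φ := h.smooth.of_le (by norm_cast)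

lemma IsTest.comp {U : Set (Heis n)} {φ : Heis n → ℝ} (h : IsTest U φ) {ψ : ℝ → ℝ}
    (hψ : ContDiff ℝ ∞ ψ) (h0 : ψ 0 = 0) : IsTest U fun x => ψ (φ x) where
  smooth := hψ.comp h.smooth
  compact := h.compact.comp_left h0
  support := (closure_mono (Function.support_comp_subset h0 φ)).trans h.support

lemma IsTest.horGrad_memLp {U : Set (Heis n)} {φ : Heis n → ℝ} (h : IsTest U φ) (q : ℝ≥0∞)
    (B : Set (Heis n)) : MemLp (horGrad φ) q (volume.restrict B) := by
  have hc : HasCompactSupport (horGrad φ) :=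
    HasCompactSupport.intro h.compact fun x hx => Heisenberg.horGrad_eq_zero hx
  exact ((continuous_horGrad h.contDiff_one).memLp_of_hasCompactSupport hc).restrict B

lemma abs_signedIntegral_le {B : Set (Heis n)} {φ : Heis n → ℝ} (h : IsTest B φ)
    (μ : SignedMeasure (Heis n)) {K : ℝ} (hK : ∀ x, |φ x| ≤ K) :
    |signedIntegral μ φ| ≤ K * (μ.totalVariation B).toReal := by
  have key : ∀ ν : Measure (Heis n), IsFiniteMeasure ν → |∫ x, φ x ∂ν| ≤ K * (ν B).toReal := by
    intro ν _
    rw [← setIntegral_eq_integral_of_forall_compl_eq_zero (s := tsupport φ)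
      fun x hx => image_eq_zero_of_notMem_tsupport hx]
    refine (norm_setIntegral_le_of_norm_le_const (f := φ) (measure_lt_top _ _)
      fun x _ => hK x).trans ?_
    refine mul_le_mul_of_nonneg_left ?_ ((abs_nonneg _).trans (hK 0))
    exact ENNReal.toReal_mono (measure_ne_top _ _) (measure_mono h.support)
  rw [SignedMeasure.totalVariation, Measure.add_apply,
    ENNReal.toReal_add (measure_ne_top _ _) (measure_ne_top _ _), mul_add]
  exact (abs_sub _ _).trans (add_le_add (key _ inferInstance) (key _ inferInstance))

/-- The equation for the difference of the two fields, tested with `φ ∈ C_0^∞(B)`. -/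
lemma integral_inner_sub_eq {p L L' s α : ℝ} (hp : 2 ≤ p) (hL : 1 ≤ L) (hs : 0 ≤ s)
    {Ω B : Set (Heis n)} {a : Heis n → Hor n → Hor n} (ha : StructureCondition p L L' s α Ω a)
    (hΩ : IsOpen Ω) (hB : B ⊆ Ω) (hBf : volume B ≠ ⊤) {μ : SignedMeasure (Heis n)}
    {u w : Heis n → ℝ} {Xu Xw : Heis n → Hor n} (hu : IsWeakSolution p Ω a μ u Xu)
    (hw : IsWeakSolution p B a 0 w Xw) {φ : Heis n → ℝ} (hφ : IsTest B φ) :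
    ∫ x in B, inner ℝ (a x (Xw x) - a x (Xu x)) (horGrad φ x) = -signedIntegral μ φ := by
  have hgz : ∀ x, x ∉ tsupport φ → horGrad φ x = 0 := fun x hx => horGrad_eq_zero hx
  have hXu : MemLp Xu (ENNReal.ofReal p) (volume.restrict B) :=
    hu.memHW.grad_memLp.mono_measure (Measure.restrict_mono_set _ hB)
  -- `a(·, 0)` is only continuous on `Ω`, but the test function has compact support there
  have hint0 : Integrable (fun x => inner ℝ (a x 0) (horGrad φ x)) (volume.restrict B) := by
    have hc : ContinuousOn (fun x => inner ℝ (a x 0) (horGrad φ x)) (tsupport φ) := by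
      refine ContinuousOn.inner ?_ (continuous_horGrad hφ.contDiff_one).continuousOn
      refine ha.continuousOn.comp (f := fun x : Heis n => (x, (0 : Hor n))) (by fun_prop) ?_
      exact fun x hx => ⟨hB (hφ.support hx), mem_univ _⟩
    have h1 := hc.integrableOn_compact (μ := volume) hφ.compact
    rw [integrableOn_iff_integrable_of_support_subset] at h1
    · exact h1.integrableOn
    · intro x hx
      by_contra hcon
      exact hx (by simp [hgz x hcon])
  have hint : ∀ {z : Heis n → Hor n}, MemLp z (ENNReal.ofReal p) (volume.restrict B) →
      Integrable (fun x => inner ℝ (a x (z x)) (horGrad φ x)) (volume.restrict B) := by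
    intro z hz
    have h1 := (integrable_inner hp (ha.memLp_sub hp hL hs hΩ hB hBf hz MemLp.zero)
      (hφ.horGrad_memLp _ B)).add hint0
    refine h1.congr (Filter.Eventually.of_forall fun x => ?_)
    simp [inner_sub_left]
  have hwu := hw.weak φ hφ
  have huu := hu.weak φ (hφ.mono hB)
  have hzero : signedIntegral (0 : SignedMeasure (Heis n)) φ = 0 := by
    simp [signedIntegral, SignedMeasure.toJordanDecomposition_zero]
  -- both sides equal the integral over the whole space, so `B` need not be measurable
  have hset : ∫ x in Ω, inner ℝ (a x (Xu x)) (horGrad φ x) =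
      ∫ x in B, inner ℝ (a x (Xu x)) (horGrad φ x) := by
    rw [setIntegral_eq_integral_of_forall_compl_eq_zero,
      setIntegral_eq_integral_of_forall_compl_eq_zero]
    · intro x hx; simp [hφ.horGrad_eq_zero hx]
    · intro x hx; simp [(hφ.mono hB).horGrad_eq_zero hx]
  simp only [inner_sub_left]
  rw [integral_sub (hint hw.memHW.grad_memLp) (hint hXu), hwu, ← hset, huu, hzero, zero_sub]

/-! ### The comparison estimate -/

/-- A pointwise substitute for Hölder's inequality with the weight `θ`. -/
lemma le_weighted_add {p η θ y : ℝ} (hp : 2 ≤ p) (hη : 0 < η) (hθ : 0 < θ) (hθ1 : θ ≤ 1)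
    (hy : 0 ≤ y) : y ≤ η ^ (1 - p) * (θ * y ^ p) + η * θ⁻¹ := by
  rcases le_total y (η * θ⁻¹) with h | h
  · exact h.trans (le_add_of_nonneg_left (by positivity))
  · refine le_trans ?_ (le_add_of_nonneg_right (by positivity))
    have hy0 : 0 < y := lt_of_lt_of_le (by positivity) h
    have h1 : (η * θ⁻¹) ^ (p - 1) ≤ y ^ (p - 1) := Real.rpow_le_rpow (by positivity) h (by linarith)
    have h2 : θ⁻¹ ≤ θ⁻¹ ^ (p - 1) :=
      Real.self_le_rpow_of_one_le ((one_le_inv₀ hθ).2 hθ1) (by linarith)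
    have h3 : η ^ (1 - p) * η ^ (p - 1) = 1 := by
      rw [← Real.rpow_add hη]; simp
    have h4 : y ^ p = y ^ (p - 1) * y := by
      rw [← Real.rpow_add_one hy0.ne']; congr 1; ring
    have h5 : 1 ≤ η ^ (1 - p) * (θ * y ^ (p - 1)) := by
      calc (1:ℝ) = η ^ (1 - p) * (θ * (η ^ (p - 1) * θ⁻¹)) := by
            rw [show η ^ (1 - p) * (θ * (η ^ (p - 1) * θ⁻¹)) =
              (η ^ (1 - p) * η ^ (p - 1)) * (θ * θ⁻¹) by ring, h3, mul_inv_cancel₀ hθ.ne', one_mul]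
        _ ≤ _ := by
            refine mul_le_mul_of_nonneg_left (mul_le_mul_of_nonneg_left ?_ hθ.le) (by positivity)
            refine le_trans ?_ h1
            rw [Real.mul_rpow hη.le (by positivity)]
            exact mul_le_mul_of_nonneg_left h2 (by positivity)
    rw [h4]
    nlinarith

lemma inv_weight (γ t : ℝ) : (weight γ t)⁻¹ = (1 + t ^ 2) ^ (γ / 2) := by
  rw [weight, neg_div, Real.rpow_neg (by positivity), inv_inv]

lemma exists_pos_mul_le {N V : ℝ≥0∞} (hN : N ≠ ⊤) (hV : V ≠ ⊤) {δ κ : ℝ} (hδ : 0 < δ)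
    (hκ : 0 < κ) : ∃ ε : ℝ≥0∞, 0 < ε ∧ N * ε ≤ ENNReal.ofReal δ ∧ V * ε ≤ ENNReal.ofReal κ := by
  have key : ∀ {N : ℝ≥0∞} {δ : ℝ}, N ≠ ⊤ → 0 < δ →
      0 < ENNReal.ofReal δ / (N + 1) ∧ N * (ENNReal.ofReal δ / (N + 1)) ≤ ENNReal.ofReal δ := by
    intro N δ hN hδ
    refine ⟨ENNReal.div_pos (ENNReal.ofReal_pos.2 hδ).ne' (by simpa using hN), ?_⟩
    calc N * (ENNReal.ofReal δ / (N + 1)) ≤ (N + 1) * (ENNReal.ofReal δ / (N + 1)) := by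
          gcongr; exact le_self_add
      _ = ENNReal.ofReal δ := ENNReal.mul_div_cancel (by simp) (by simpa using hN)
  refine ⟨min (ENNReal.ofReal δ / (N + 1)) (ENNReal.ofReal κ / (V + 1)),
    lt_min (key hN hδ).1 (key hV hκ).1, ?_, ?_⟩
  · exact (mul_le_mul_right (min_le_left _ _) _).trans (key hN hδ).2
  · exact (mul_le_mul_right (min_le_right _ _) _).trans (key hV hκ).2

/-- Testing the equation with `ψ(φ)`, where `φ` approximates the difference of the solutions in
`HW^{1,p}` and `ψ' = weight γ (· / k)`: the weighted energy is bounded by the mass of `μ`. -/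
lemma exists_test_integral_le {p L L' s α : ℝ} (hp : 2 ≤ p) (hL : 1 ≤ L) (hs : 0 ≤ s)
    {Ω B : Set (Heis n)} {a : Heis n → Hor n → Hor n} (ha : StructureCondition p L L' s α Ω a)
    (hΩ : IsOpen Ω) (hB : B ⊆ Ω) (hBf : volume B ≠ ⊤) {μ : SignedMeasure (Heis n)}
    {u w : Heis n → ℝ} {Xu Xw : Heis n → Hor n} (hu : IsWeakSolution p Ω a μ u Xu)
    (hw : IsWeakSolution p B a 0 w Xw) (hwu : MemHW0 p B (w - u) (Xw - Xu)) {γ C : ℝ} (hγ : 0 ≤ γ)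
    (hC : ∀ t, |weightPrim γ t| ≤ C) {k δ κ : ℝ} (hk : 0 < k) (hδ : 0 < δ) (hκ : 0 < κ) :
    ∃ φ, IsTest B φ ∧
      (∫⁻ x, ‖horGrad φ x‖ₑ ≤ (∫⁻ x in B, ‖Xw x - Xu x‖ₑ) + ENNReal.ofReal κ) ∧
      Integrable (fun x => weight γ (φ x / k) *
        inner ℝ (a x (Xw x) - a x (Xu x)) (Xw x - Xu x)) (volume.restrict B) ∧
      ∫ x in B, weight γ (φ x / k) * inner ℝ (a x (Xw x) - a x (Xu x)) (Xw x - Xu x) ≤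
        k * C * (μ.totalVariation B).toReal + δ := by
  have : IsFiniteMeasure (volume.restrict B) := ⟨by
    rw [Measure.restrict_apply_univ]; exact hBf.lt_top⟩
  have hXu : MemLp Xu (ENNReal.ofReal p) (volume.restrict B) :=
    hu.memHW.grad_memLp.mono_measure (Measure.restrict_mono_set _ hB)
  have hD := ha.memLp_sub hp hL hs hΩ hB hBf hw.memHW.grad_memLp hXu
  have hg : MemLp (Xw - Xu) (ENNReal.ofReal p) (volume.restrict B) := hwu.memHW.grad_memLp
  set D : Heis n → Hor n := fun x => a x (Xw x) - a x (Xu x) with hDdef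
  set ν := volume.restrict B with hν
  have hp1 : (1:ℝ≥0∞) ≤ ENNReal.ofReal p := by
    rw [← ENNReal.ofReal_one]; exact ENNReal.ofReal_le_ofReal (by linarith)
  have hexp : 0 ≤ 1 / (1:ℝ≥0∞).toReal - 1 / (ENNReal.ofReal p).toReal := by
    rw [ENNReal.toReal_ofReal (by linarith), ENNReal.toReal_one, sub_nonneg, div_one]
    exact (div_le_one (by linarith)).2 (by linarith)
  -- closeness in `L^p` of the gradients controls both the `L¹` norm and the pairing with `D`
  obtain ⟨ε, hε, hε1, hε2⟩ := exists_pos_mul_le hD.2.ne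
    (ENNReal.rpow_ne_top_of_nonneg hexp (measure_ne_top ν univ)) hδ hκ
  obtain ⟨φ, hφ, hφε⟩ := hwu.approx ε hε
  have hclose : eLpNorm (Xw - Xu - horGrad φ) (ENNReal.ofReal p) ν ≤ ε :=
    (le_add_self.trans_lt hφε).le
  have hXφ := hφ.horGrad_memLp (ENNReal.ofReal p) B
  have hi1 := integrable_inner hp hD hXφ
  have hi2 := integrable_inner hp hD (hg.sub hXφ)
  have hcw : Continuous fun x => weight γ (φ x / k) :=
    (contDiff_weight γ).continuous.comp (hφ.smooth.continuous.div_const k)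
  have hwt : ∀ {f : Heis n → ℝ}, Integrable f ν →
      Integrable (fun x => weight γ (φ x / k) * f x) ν := fun hf =>
    hf.bdd_mul (c := 1) hcw.aestronglyMeasurable (Filter.Eventually.of_forall fun x => by
      rw [Real.norm_of_nonneg (weight_pos _ _).le]; exact weight_le_one hγ _)
  refine ⟨φ, hφ, ?_, ?_, ?_⟩
  · have h1 : ∫⁻ x, ‖horGrad φ x‖ₑ ≤ ∫⁻ x in B, ‖horGrad φ x‖ₑ := by
      have hK : MeasurableSet (tsupport φ) := (isClosed_tsupport φ).measurableSet
      have h2 : (tsupport φ).indicator (fun x => ‖horGrad φ x‖ₑ) = fun x => ‖horGrad φ x‖ₑ := by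
        refine indicator_eq_self.2 fun x hx => ?_
        by_contra hc
        exact hx (by simp [horGrad_eq_zero hc])
      rw [← h2, lintegral_indicator hK, h2]
      exact lintegral_mono_set hφ.support
    refine h1.trans ?_
    calc ∫⁻ x in B, ‖horGrad φ x‖ₑ
        ≤ ∫⁻ x in B, (‖Xw x - Xu x‖ₑ + ‖(Xw - Xu - horGrad φ) x‖ₑ) := by
          refine lintegral_mono fun x => ?_
          have := enorm_sub_le (a := Xw x - Xu x) (b := (Xw - Xu - horGrad φ) x)
          simpa using this
      _ = (∫⁻ x in B, ‖Xw x - Xu x‖ₑ) + eLpNorm (Xw - Xu - horGrad φ) 1 ν := by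
          have hm : AEMeasurable (fun x => ‖Xw x - Xu x‖ₑ) ν := hg.1.enorm
          rw [lintegral_add_left' hm, eLpNorm_one_eq_lintegral_enorm]
      _ ≤ _ := by
          gcongr
          refine (eLpNorm_le_eLpNorm_mul_rpow_measure_univ hp1 (hg.1.sub hXφ.1)).trans ?_
          rw [mul_comm]
          exact (mul_le_mul_right hclose _).trans hε2
  · exact hwt (integrable_inner hp hD hg)
  · have hψ : ∀ t, HasDerivAt (fun t => k * weightPrim γ (t / k)) (weight γ (t / k)) t := by
      intro t
      have := ((hasDerivAt_weightPrim γ (t / k)).comp t ((hasDerivAt_id t).div_const k)).const_mul k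
      refine this.congr_deriv ?_
      field_simp
    have hψs : ContDiff ℝ ∞ fun t => k * weightPrim γ (t / k) :=
      contDiff_const.mul ((contDiff_weightPrim γ).comp (by fun_prop))
    have htest := hφ.comp hψs (by simp [weightPrim])
    have heq := integral_inner_sub_eq hp hL hs ha hΩ hB hBf hu hw htest
    have hgrad : ∀ x, horGrad (fun y => k * weightPrim γ (φ y / k)) x =
        weight γ (φ x / k) • horGrad φ x := by
      intro x
      have := horGrad_comp (hψ (φ x)).differentiableAt
        (hφ.contDiff_one.differentiable one_ne_zero x)
      rwa [(hψ (φ x)).deriv] at this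
    simp only [hgrad, inner_smul_right] at heq
    have hμ := abs_signedIntegral_le htest μ (K := k * C) fun x => by
      rw [abs_mul, abs_of_pos hk]
      exact mul_le_mul_of_nonneg_left (hC _) hk.le
    have hsplit : ∀ x, weight γ (φ x / k) * inner ℝ (D x) (Xw x - Xu x) =
        weight γ (φ x / k) * inner ℝ (D x) (horGrad φ x) +
          weight γ (φ x / k) * inner ℝ (D x) ((Xw - Xu - horGrad φ) x) := by
      intro x
      rw [← mul_add, ← inner_add_right]
      simp
    rw [integral_congr_ae (Filter.Eventually.of_forall hsplit), integral_add (hwt hi1) (hwt hi2)]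
    refine add_le_add ?_ ?_
    · rw [heq]
      exact (neg_le_abs _).trans hμ
    · refine (le_abs_self _).trans ?_
      rw [← Real.norm_eq_abs]
      refine (norm_integral_le_integral_norm _).trans ?_
      refine (integral_mono (hwt hi2).norm hi2.norm fun x => ?_).trans ?_
      · simp only [norm_mul]
        rw [Real.norm_of_nonneg (weight_pos _ _).le]
        exact mul_le_of_le_one_left (norm_nonneg _) (weight_le_one hγ _)
      · rw [integral_norm_eq_lintegral_enorm hi2.1, ← eLpNorm_one_eq_lintegral_enorm]
        refine ENNReal.toReal_le_of_le_ofReal hδ.le ?_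
        exact ((eLpNorm_inner_le hp hD (hg.sub hXφ)).trans (mul_le_mul_right hclose _)).trans hε1

/-- The comparison estimate, with the integral of `𝔛w - 𝔛u` normalised by `r ^ Q`. -/
lemma exists_rpow_le (hn : 1 ≤ n) {p : ℝ} (hp : 2 ≤ p) : ∃ C : ℝ, 0 < C ∧
    ∀ {L L' s α : ℝ}, 1 ≤ L → 0 ≤ s → ∀ {Ω : Set (Heis n)} {a : Heis n → Hor n → Hor n},
      StructureCondition p L L' s α Ω a → IsOpen Ω → ∀ {μ : SignedMeasure (Heis n)}
      {u w : Heis n → ℝ} {Xu Xw : Heis n → Hor n} {x₀ : Heis n} {r : ℝ}, 0 < r →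
      ccBall x₀ r ⊆ Ω → IsWeakSolution p Ω a μ u Xu → IsWeakSolution p (ccBall x₀ r) a 0 w Xw →
      MemHW0 p (ccBall x₀ r) (w - u) (Xw - Xu) →
      ((∫ x in ccBall x₀ r, ‖Xw x - Xu x‖) / r ^ homDim n) ^ (p - 1) ≤
        C * ((μ.totalVariation (ccBall x₀ r)).toReal / r ^ (homDim n - 1)) := by
  have hγ := one_lt_sobolevExp (n := n)
  set γ := sobolevExp n
  obtain ⟨C₁, hC₁, hψ⟩ := exists_abs_weightPrim_le hγ
  obtain ⟨C₂, hC₂, hsob⟩ := exists_lintegral_one_add_sq_rpow_le hn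
  -- with this choice the term `η θ⁻¹` contributes half of the left-hand side
  set η : ℝ := 1 / (2 * C₂) with hη
  have hη0 : 0 < η := by positivity
  set K : ℝ := η ^ (1 - p) * 4 ^ (p - 1) with hK
  have hK0 : 0 < K := by positivity
  refine ⟨2 * K * C₁, by positivity, ?_⟩
  intro L L' s α hL hs Ω a ha hΩ μ u w Xu Xw x₀ r hr hB hu hw hwu
  set B := ccBall x₀ r with hBdef
  set Q := homDim n with hQ
  set M := (μ.totalVariation B).toReal with hM
  have hM0 : 0 ≤ M := ENNReal.toReal_nonneg
  have hBT : B ⊆ mul (-x₀) ⁻¹' box n r := ccBall_subset x₀ r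
  have hBf : volume B ≠ ⊤ := ((measure_mono hBT).trans_lt
    (by rw [volume_translate_box _ hr.le]; exact ENNReal.ofReal_lt_top)).ne
  have : IsFiniteMeasure (volume.restrict B) := ⟨by
    rw [Measure.restrict_apply_univ]; exact hBf.lt_top⟩
  have hp1 : (1:ℝ≥0∞) ≤ ENNReal.ofReal p := by
    rw [← ENNReal.ofReal_one]; exact ENNReal.ofReal_le_ofReal (by linarith)
  have hgi : Integrable (fun x => Xw x - Xu x) (volume.restrict B) :=
    hwu.memHW.grad_memLp.integrable hp1
  set I := ∫ x in B, ‖Xw x - Xu x‖ with hI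
  have hIl : ∫⁻ x in B, ‖Xw x - Xu x‖ₑ = ENNReal.ofReal I :=
    (ofReal_integral_norm_eq_lintegral_enorm hgi).symm
  have hI0 : 0 ≤ I := integral_nonneg fun x => norm_nonneg _
  rcases hI0.eq_or_lt with h0 | hIpos
  · rw [← h0, zero_div, Real.zero_rpow (by linarith)]
    positivity
  set A := I / r ^ Q with hA
  have hA0 : 0 < A := by positivity
  have hrQ : r * r ^ (Q - 1) = r ^ Q := by
    rw [mul_comm]; exact pow_sub_one_mul (by simp [hQ, homDim]) r
  have hIA : I = A * r ^ Q := by rw [hA]; field_simp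
  set k := A * r with hk
  have hk0 : 0 < k := by positivity
  have hkI : k * r ^ (Q - 1) = I := by rw [hk, hIA, ← hrQ]; ring
  have hmain : ∀ δ : ℝ, 0 < δ → I / 2 ≤ K * A ^ (1 - p) * (k * C₁ * M + δ) := by
    intro δ hδ
    obtain ⟨φ, hφ, hφI, hint, hle⟩ := exists_test_integral_le hp hL hs ha hΩ hB hBf hu hw hwu
      (by linarith : 0 ≤ γ) hψ hk0 hδ hIpos
    have hφI' : ∫⁻ x, ‖horGrad φ x‖ₑ ≤ ENNReal.ofReal (2 * k * r ^ (homDim n - 1)) := by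
      refine hφI.trans_eq ?_
      rw [hIl, ← ENNReal.ofReal_add hIpos.le hIpos.le, mul_assoc, hkI, two_mul]
    have hS := hsob φ x₀ r k hφ.contDiff_one hr hk0 (fun x hx => hφ.eq_zero fun hc => hx (hBT hc))
      hφI'
    replace hS := (lintegral_mono_set hBT).trans hS
    have hcw : Continuous fun x => (1 + (φ x / k) ^ 2) ^ (γ / 2) :=
      (by have := hφ.smooth.continuous; fun_prop :
        Continuous fun x => 1 + (φ x / k) ^ 2).rpow_const fun x => Or.inr (by linarith)
    have hSi : Integrable (fun x => (1 + (φ x / k) ^ 2) ^ (γ / 2)) (volume.restrict B) :=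
      ⟨hcw.aestronglyMeasurable, (hasFiniteIntegral_iff_ofReal
        (Filter.Eventually.of_forall fun x => by positivity)).2
        (hS.trans_lt ENNReal.ofReal_lt_top)⟩
    have hS' : ∫ x in B, (1 + (φ x / k) ^ 2) ^ (γ / 2) ≤ C₂ * r ^ Q := by
      rw [integral_eq_lintegral_of_nonneg_ae (Filter.Eventually.of_forall fun x => by positivity)
        hcw.aestronglyMeasurable]
      exact ENNReal.toReal_le_of_le_ofReal (by positivity) hS
    have hpt : ∀ᵐ x ∂(volume.restrict B), ‖Xw x - Xu x‖ ≤
        K * A ^ (1 - p) * (weight γ (φ x / k) *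
          inner ℝ (a x (Xw x) - a x (Xu x)) (Xw x - Xu x)) +
        η * A * (1 + (φ x / k) ^ 2) ^ (γ / 2) := by
      filter_upwards [ae_restrict_mem_of_subset hΩ hB] with x hx
      have hθ := weight_pos γ (φ x / k)
      have h1 := le_weighted_add hp hη0 hθ (weight_le_one (by linarith) _)
        (div_nonneg (norm_nonneg (Xw x - Xu x)) hA0.le)
      have h2 := ha.le_inner hp hx (Xw x) (Xu x)
      have h3 : ‖Xw x - Xu x‖ ^ p ≤ 4 ^ (p - 1) *
          inner ℝ (a x (Xw x) - a x (Xu x)) (Xw x - Xu x) := by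
        have h4 : (4:ℝ) ^ (p - 1) * (1 / 4) ^ (p - 1) = 1 := by
          rw [← Real.mul_rpow (by norm_num) (by norm_num)]; norm_num
        calc _ = 4 ^ (p - 1) * ((1 / 4) ^ (p - 1) * ‖Xw x - Xu x‖ ^ p) := by
              rw [← mul_assoc, h4, one_mul]
          _ ≤ _ := mul_le_mul_of_nonneg_left h2 (by positivity)
      rw [Real.div_rpow (norm_nonneg _) hA0.le, inv_weight, div_le_iff₀ hA0] at h1
      refine h1.trans ?_
      have hAp : A ^ (1 - p) = (A ^ p)⁻¹ * A := by
        rw [← Real.rpow_neg hA0.le, ← Real.rpow_add_one hA0.ne']; congr 1; ring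
      rw [hAp, hK]
      have h5 : η ^ (1 - p) * (weight γ (φ x / k) * ((A ^ p)⁻¹ * ‖Xw x - Xu x‖ ^ p)) * A ≤
          η ^ (1 - p) * (weight γ (φ x / k) * ((A ^ p)⁻¹ * (4 ^ (p - 1) *
          inner ℝ (a x (Xw x) - a x (Xu x)) (Xw x - Xu x)))) * A := by gcongr
      rw [div_eq_inv_mul (‖Xw x - Xu x‖ ^ p)]
      linarith
    have hfin : I ≤ K * A ^ (1 - p) * (k * C₁ * M + δ) + η * A * (C₂ * r ^ Q) := by
      refine (integral_mono_ae hgi.norm ((hint.const_mul _).add (hSi.const_mul _)) hpt).trans ?_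
      simp only [Pi.add_apply]
      rw [integral_add (hint.const_mul _) (hSi.const_mul _), integral_const_mul, integral_const_mul]
      gcongr
    have hhalf : η * A * (C₂ * r ^ Q) = I / 2 := by
      rw [hIA, hη]; field_simp
    linarith
  have hlim : I / 2 ≤ K * A ^ (1 - p) * (k * C₁ * M) := by
    refine le_of_forall_pos_le_add fun ε hε => ?_
    have := hmain (ε / (K * A ^ (1 - p))) (by positivity)
    rw [mul_add] at this
    refine this.trans_eq ?_
    congr 1
    field_simp
  have hAA : A ^ (1 - p) * A ^ (p - 1) = 1 := by rw [← Real.rpow_add hA0]; simp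
  have h1 := mul_le_mul_of_nonneg_left hlim (by positivity : 0 ≤ A ^ (p - 1))
  have h2 : A ^ (p - 1) * (K * A ^ (1 - p) * (k * C₁ * M)) = K * (k * C₁ * M) := by
    linear_combination (K * (k * C₁ * M)) * hAA
  rw [h2, ← hkI, hk] at h1
  rw [mul_div_assoc', le_div_iff₀ (by positivity)]
  have hpos : 0 < A * r / 2 := by positivity
  refine le_of_mul_le_mul_left ?_ hpos
  calc _ = A ^ (p - 1) * (A * r * r ^ (Q - 1) / 2) := by ring
    _ ≤ _ := h1
    _ = _ := by ring

end Heisenberg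
end

theorem lemma3p3 (n : ℕ) (hn : 1 ≤ n) (p : ℝ) (hp : 2 ≤ p) (L : ℝ) (hL : 1 ≤ L) :
    ∃ c : ℝ, 0 < c ∧
      ∀ (L' s α : ℝ), 1 ≤ L' → 0 ≤ s → 0 < α → α ≤ 1 →
      ∀ Ω : Set (Heisenberg.Heis n), IsOpen Ω → IsConnected Ω →
      ∀ a : Heisenberg.Heis n → Heisenberg.Hor n → Heisenberg.Hor n,
        Heisenberg.StructureCondition p L L' s α Ω a →
      ∀ μ : MeasureTheory.SignedMeasure (Heisenberg.Heis n), μ.totalVariation Ωᶜ = 0 →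
      ∀ (u : Heisenberg.Heis n → ℝ) (Xu : Heisenberg.Heis n → Heisenberg.Hor n),
        Heisenberg.IsWeakSolution p Ω a μ u Xu →
      ∀ (x₀ : Heisenberg.Heis n) (R : ℝ), 0 < R → Heisenberg.ccBall x₀ (2 * R) ⊆ Ω →
      ∀ (w : Heisenberg.Heis n → ℝ) (Xw : Heisenberg.Heis n → Heisenberg.Hor n),
        Heisenberg.IsWeakSolution p (Heisenberg.ccBall x₀ (2 * R)) a 0 w Xw →
        Heisenberg.MemHW0 p (Heisenberg.ccBall x₀ (2 * R)) (w - u) (Xw - Xu) →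
        ⨍ x in Heisenberg.ccBall x₀ (2 * R), ‖Xw x - Xu x‖ ≤
          c * ((μ.totalVariation (Heisenberg.ccBall x₀ (2 * R))).toReal /
            R ^ (Heisenberg.homDim n - 1)) ^ (1 / (p - 1)) := by
  obtain ⟨C, hC, hmain⟩ := Heisenberg.exists_rpow_le hn hp
  have hω := Heisenberg.boxVol_pos (n := n)
  refine ⟨74 ^ Heisenberg.homDim n / Heisenberg.boxVol n * C ^ (1 / (p - 1)), by positivity, ?_⟩
  intro L' s α _ hs _ _ Ω hΩ _ a ha μ _ u Xu hu x₀ R hR hB w Xw hw hwu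
  have hr : 0 < 2 * R := by positivity
  have h := hmain hL hs ha hΩ hr hB hu hw hwu
  set B := Heisenberg.ccBall x₀ (2 * R)
  set Q := Heisenberg.homDim n
  set M := (μ.totalVariation B).toReal
  set I := ∫ x in B, ‖Xw x - Xu x‖ with hI
  have hM0 : 0 ≤ M := ENNReal.toReal_nonneg
  have hI0 : 0 ≤ I := integral_nonneg fun x => norm_nonneg _
  have hp1 : 0 < p - 1 := by linarith
  -- the inner box supplies the lower volume bound of the ball, whence the factor `74 ^ Q`
  have hvol : Heisenberg.boxVol n * (2 * R / 74) ^ Q ≤ volume.real B := by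
    have hBf : volume B ≠ ⊤ := ((measure_mono (Heisenberg.ccBall_subset x₀ (2 * R))).trans_lt
      (by rw [Heisenberg.volume_translate_box _ hr.le]; exact ENNReal.ofReal_lt_top)).ne
    refine (ENNReal.ofReal_le_iff_le_toReal hBf).1 ?_
    rw [← Heisenberg.volume_translate_box (-x₀) (by positivity)]
    exact measure_mono (Heisenberg.subset_ccBall hn x₀ hr)
  have hA : I / (2 * R) ^ Q ≤ C ^ (1 / (p - 1)) * (M / R ^ (Q - 1)) ^ (1 / (p - 1)) := by
    rw [← Real.mul_rpow hC.le (by positivity), ← Real.rpow_le_rpow_iff (z := p - 1) (by positivity)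
      (by positivity) hp1, ← Real.rpow_mul (by positivity), one_div_mul_cancel hp1.ne',
      Real.rpow_one]
    refine h.trans (mul_le_mul_of_nonneg_left ?_ hC.le)
    gcongr
    linarith
  rw [setAverage_eq, smul_eq_mul, ← hI, inv_mul_eq_div]
  calc I / volume.real B ≤ I / (Heisenberg.boxVol n * (2 * R / 74) ^ Q) := by gcongr
    _ = 74 ^ Q / Heisenberg.boxVol n * (I / (2 * R) ^ Q) := by
        rw [div_pow]; field_simp
    _ ≤ _ := by
        rw [mul_assoc]
        exact mul_le_mul_of_nonneg_left hA (by positivity)
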